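/- A (finite) hypergraph $H=(V,E)$ consists of a finite vertex set $V$ and a set $E$ of subsets of $V$, called edges. It is $n$-uniform if every edge has exactly $n$ vertices, and $b$-simple if $|A\cap B|\le b$ for any two distinct edges $A,B\in E$. It is $r$-colorable if there is a map $V\to\{1,\dots,r\}$ under which every edge contains two vertices of different colors. Let $m(n,r,b)$ denote the minimum number of edges of an $n$-uniform $b$-simple hypergraph that is not $r$-colorable. **Corollary.** For every integer $b\ge 2$ there is an $n_0=n_0(b)$ such that for every integer $r\ge 2$ there is a constant $c=c(r,b)>0$, depending only on $r$ and $b$, such that for all integers $n>n_0$, $$m(n,r,b)\ \ge\ c\cdot r^{\,n(1+1/b)}.$$ -/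

import Mathlib

namespace Hypergraph

/-- `H` is `n`-uniform: every edge is a finite set with exactly `n` vertices. -/
def IsUniform {α : Type*} (H : Hypergraph α) (n : ℕ) : Prop :=
  ∀ e ∈ H.edgeSet, e.Finite ∧ e.ncard = n

/-- `H` is `b`-simple: any two distinct edges share at most `b` vertices. -/
def IsSimple {α : Type*} (H : Hypergraph α) (b : ℕ) : Prop :=
  ∀ A ∈ H.edgeSet, ∀ B ∈ H.edgeSet, A ≠ B → (A ∩ B).encard ≤ b

/-- A vertex `r`-coloring is proper if every edge contains two vertices of different colors. -/
def IsProperColoring {α : Type*} (H : Hypergraph α) {r : ℕ} (f : H.vertexSet → Fin r) : Prop :=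
  ∀ e ∈ H.edgeSet, ∃ x y : H.vertexSet, (x : α) ∈ e ∧ (y : α) ∈ e ∧ f x ≠ f y

/-- `H` is `r`-colorable: it has a proper vertex `r`-coloring. -/
def IsColorable {α : Type*} (H : Hypergraph α) (r : ℕ) : Prop :=
  ∃ f : H.vertexSet → Fin r, H.IsProperColoring f

/-- The numbers of edges of the finite `n`-uniform `b`-simple hypergraphs that are not
`r`-colorable. -/
def nonColorableSizes (n r b : ℕ) : Set ℕ :=
  {k | ∃ (α : Type) (H : Hypergraph α), H.vertexSet.Finite ∧ H.IsUniform n ∧ H.IsSimple b ∧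
    ¬ H.IsColorable r ∧ H.edgeSet.ncard = k}

/-- Such hypergraphs exist, so the minimum defining `m(n, r, b)` is attained. -/
theorem nonColorableSizes_nonempty (n r b : ℕ) (hb : 1 ≤ b) :
    (nonColorableSizes n r b).Nonempty := by
  classical
  obtain ⟨ι, _, hι⟩ := Combinatorics.Line.exists_mono_in_high_dimension (Fin n) (Fin r)
  let H : Hypergraph (ι → Fin n) :=
    ⟨Set.univ, Set.range fun l : Combinatorics.Line (Fin n) ι => Set.range l, by simp⟩
  -- a point pair on a line determines it
  have key : ∀ (l l' : Combinatorics.Line (Fin n) ι) (x y : ι → Fin n), x ≠ y →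
      x ∈ Set.range l → y ∈ Set.range l → x ∈ Set.range l' → y ∈ Set.range l' →
      l.idxFun = l'.idxFun := by
    rintro l l' x y hxy ⟨a, rfl⟩ ⟨c, rfl⟩ ⟨a', ha⟩ ⟨c', hc⟩
    have hac : a ≠ c := fun h => hxy (by rw [h])
    have hac' : a' ≠ c' := fun h => hxy (by rw [← ha, ← hc, h])
    funext i
    have h1 := congrFun ha i
    have h2 := congrFun hc i
    simp only [Combinatorics.Line.apply_def] at h1 h2
    cases h : l.idxFun i <;> cases h' : l'.idxFun i <;> simp_all
  have inj : ∀ l : Combinatorics.Line (Fin n) ι, Function.Injective l := by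
    intro l a c h
    obtain ⟨i, hi⟩ := l.proper
    have := congrFun h i
    simpa [Combinatorics.Line.apply_def, hi] using this
  refine ⟨_, ι → Fin n, H, Set.toFinite _, ?_, ?_, ?_, rfl⟩
  · rintro _ ⟨l, rfl⟩
    refine ⟨Set.toFinite _, ?_⟩
    show (Set.range l).ncard = n
    rw [← Set.image_univ, Set.ncard_image_of_injective _ (inj l)]
    simp
  · rintro _ ⟨l, rfl⟩ _ ⟨l', rfl⟩ hne
    refine le_trans ?_ (by exact_mod_cast hb : (1 : ℕ∞) ≤ b)
    rw [Set.encard_le_one_iff]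
    rintro x y ⟨hx, hx'⟩ ⟨hy, hy'⟩
    by_contra hxy
    apply hne
    have := key l l' x y hxy hx hy hx' hy'
    show Set.range l = Set.range l'
    congr 1
    funext a i
    simp [this]
  · rintro ⟨f, hf⟩
    obtain ⟨l, k, hl⟩ := hι (fun x => f ⟨x, trivial⟩)
    obtain ⟨⟨x, _⟩, ⟨y, _⟩, ⟨a, ha⟩, ⟨c, hc⟩, hxy⟩ := hf _ ⟨l, rfl⟩
    simp only at ha hc
    subst ha hc
    exact hxy ((hl a).trans (hl c).symm)

/-- `m(n, r, b)`: the minimum number of edges of an `n`-uniform `b`-simple hypergraph that is not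
`r`-colorable. It is attained for `1 ≤ b`, by `nonColorableSizes_nonempty`. -/
noncomputable def minEdges (n r b : ℕ) : ℕ :=
  sInf (nonColorableSizes n r b)

end Hypergraph

/-! Trimming reduces the bound to coloring under a degree condition. From every edge delete `b`
vertices of largest degree. If `d` trimmed edges share a vertex, the `b`-sets deleted from them are
distinct by `b`-simplicity and consist of vertices of degree at least `d`, so at least `d ^ (1 / b)`
vertices have such a degree; double counting on about `(d / 2) ^ (1 / b)` of them gives order `d ^
(1 + 1 / b)` edges (`trimmed_degree_bound`). If all trimmed degrees are below a constant times `r ^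
n`, the trimmed hypergraph is `r`-colorable (`exists_coloring_of_degree_le`), and its coloring is
proper for the original edges too.

For the coloring, every vertex receives a random color and a random level. While a monochromatic
edge has a non-recolored vertex of level below `q`, its lowest such vertex moves to the next color
and blames that edge. Distinct vertices blame distinct edges, so a monochromatic edge that survives
yields a tree of edges, linked through recolored vertices (`Recoloring.exists_treeEvent`). With `t`
the binary logarithm of `n` rounded up, `q = 2 * t` and `L = 4 * t`, two kinds of tree occur. Small
trees have fewer than `L` links, and the root vertices outside the links have level at least `q`,
which costs a factor `1 / n`. Large trees have between `L` and `2 * L` links, and their number of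
links alone makes them unlikely.

A tree with `m` links and vertex set `U` has probability at most of order `r * r ^ (-#U) * (3 * r /
n) ^ m`, times a factor for the root (`pr_treeEvent_le`). The sum of `r ^ (-#U)` over the trees
through a vertex is bounded by exploring each tree from an edge at that vertex (`sum_trees_le`);
keeping `#U` in the weight accounts for overlapping edges. The product decays like `4 ^ (-m)`, and
`local_lemma` with `τ = 1 / n` excludes all trees at once. -/

namespace HypergraphColoring
open Finset
open scoped Classical

/-! ### A local lemma on product spaces -/

section LocalLemma

variable {V S : Type*} [Fintype V] [Fintype S]

/-- The probability of an event under the uniform measure on `V → S`. -/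
noncomputable def pr (P : (V → S) → Prop) : ℝ :=
  (#{ω : V → S | P ω} : ℝ) / Fintype.card (V → S)

/-- The event is determined by the coordinates in `U`. -/
def DeterminedBy (P : (V → S) → Prop) (U : Finset V) : Prop :=
  ∀ ω ω' : V → S, (∀ u ∈ U, ω u = ω' u) → P ω → P ω'

lemma pr_nonneg (P : (V → S) → Prop) : 0 ≤ pr P := by unfold pr; positivity

lemma pr_eq_card_div {P : (V → S) → Prop} {A : Finset (V → S)} (h : ∀ ω, ω ∈ A ↔ P ω) :
    pr P = (#A : ℝ) / Fintype.card (V → S) := by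
  unfold pr
  congr 3
  ext ω
  simp [h]

lemma pr_mono {P Q : (V → S) → Prop} (h : ∀ ω, P ω → Q ω) : pr P ≤ pr Q := by
  unfold pr
  gcongr with ω
  exact h _

lemma pr_true [Nonempty S] : pr (fun _ : V → S => True) = 1 := by
  have : (Fintype.card (V → S) : ℝ) ≠ 0 := by exact_mod_cast Fintype.card_ne_zero
  rw [pr_eq_card_div (A := univ) (by simp), card_univ, div_self this]

lemma pr_exists_le {ι : Type*} (J : Finset ι) (P : ι → (V → S) → Prop) :
    pr (fun ω => ∃ j ∈ J, P j ω) ≤ ∑ j ∈ J, pr (P j) := by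
  rw [pr_eq_card_div (A := J.biUnion fun j => {ω | P j ω}) (by simp)]
  unfold pr
  rw [← sum_div]
  gcongr
  exact_mod_cast card_biUnion_le

lemma pr_or_le (P Q : (V → S) → Prop) : pr (fun ω => P ω ∨ Q ω) ≤ pr P + pr Q := by
  rw [pr_eq_card_div (A := ({ω | P ω} : Finset (V → S)) ∪ ({ω | Q ω} : Finset (V → S))) (by simp)]
  unfold pr
  rw [← add_div]
  gcongr
  exact_mod_cast card_union_le _ _

lemma pr_box [Nonempty S] (C : V → Finset S) :
    pr (fun ω => ∀ u, ω u ∈ C u) = ∏ u, (#(C u) : ℝ) / Fintype.card S := by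
  rw [pr_eq_card_div (A := Fintype.piFinset C) (by simp), Fintype.card_piFinset, prod_div_distrib,
    Fintype.card_fun]
  simp

/-- Exchanging the coordinates outside `U` between two sample points is an involution that matches
pairs whose first entry satisfies both events with pairs whose entries satisfy `P` and `Q`
respectively. -/
lemma pr_and_eq_mul [Nonempty S] {P Q : (V → S) → Prop} {U : Finset V}
    (hP : DeterminedBy P U) (hQ : DeterminedBy Q Uᶜ) :
    pr (fun ω => P ω ∧ Q ω) = pr P * pr Q := by
  have key : #{ω : V → S | P ω ∧ Q ω} * #(univ : Finset (V → S)) =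
      #{ω : V → S | P ω} * #{ω : V → S | Q ω} := by
    rw [← card_product, ← card_product]
    let Φ : (V → S) × (V → S) → (V → S) × (V → S) := fun p =>
      (fun u => if u ∈ U then p.1 u else p.2 u, fun u => if u ∈ U then p.2 u else p.1 u)
    have hΦ : ∀ p, Φ (Φ p) = p := by
      rintro ⟨a, c⟩
      ext u <;> by_cases hu : u ∈ U <;> simp [Φ, hu]
    refine card_bij' (fun p _ => Φ p) (fun p _ => Φ p) ?_ ?_ (fun p _ => hΦ p) (fun p _ => hΦ p)
    · rintro ⟨a, c⟩ h
      simp only [mem_product, mem_filter, mem_univ, true_and, and_true] at h ⊢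
      refine ⟨hP a _ (fun u hu => by simp [Φ, hu]) h.1, hQ a _ (fun u hu => ?_) h.2⟩
      have : u ∉ U := by simpa using hu
      simp [Φ, this]
    · rintro ⟨a, c⟩ h
      simp only [mem_product, mem_filter, mem_univ, true_and, and_true] at h ⊢
      refine ⟨hP a _ (fun u hu => by simp [Φ, hu]) h.1, hQ c _ (fun u hu => ?_) h.2⟩
      have : u ∉ U := by simpa using hu
      simp [Φ, this]
  have h0 : (Fintype.card (V → S) : ℝ) ≠ 0 := by exact_mod_cast Fintype.card_ne_zero
  have key' : (#{ω : V → S | P ω ∧ Q ω} : ℝ) * Fintype.card (V → S) =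
      #{ω : V → S | P ω} * #{ω : V → S | Q ω} := by
    rw [← card_univ]; exact_mod_cast key
  unfold pr
  field_simp
  linarith

/-- A local lemma for events with supports of unbounded size. -/
theorem local_lemma [Nonempty S] {ι : Type*} (J : Finset ι) (supp : ι → Finset V)
    (Ev : ι → (V → S) → Prop) (hdet : ∀ j ∈ J, DeterminedBy (Ev j) (supp j))
    (hne : ∀ j ∈ J, (supp j).Nonempty) (τ : ℝ) (hτ0 : 0 ≤ τ) (hτ1 : τ < 1)
    (hsum : ∀ v, ∑ j ∈ J with v ∈ supp j, pr (Ev j) * ((1 - τ)⁻¹) ^ #(supp j) ≤ τ) :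
    ∃ ω, ∀ j ∈ J, ¬ Ev j ω := by
  have hpos : 0 < 1 - τ := by linarith
  let good : Finset V → (V → S) → Prop := fun W ω => ∀ j ∈ J, supp j ⊆ W → ¬ Ev j ω
  -- Adding one vertex to `W` keeps at least the fraction `1 - τ` of the probability that all events
  -- supported in `W` fail.
  have step : ∀ k, ∀ W : Finset V, #W = k → ∀ v ∉ W,
      (1 - τ) * pr (good W) ≤ pr (good (insert v W)) := by
    intro k
    induction k using Nat.strong_induction_on with
    | _ k ih =>
    intro W hW v hv
    -- Inserting `T` vertex by vertex invokes the induction hypothesis only at proper subsets of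
    -- `W`.
    have chain : ∀ T : Finset V, ∀ W0 : Finset V, W0 ∪ T = W → Disjoint W0 T →
        pr (good W0) ≤ ((1 - τ)⁻¹) ^ #T * pr (good W) := by
      intro T
      induction T using Finset.induction_on with
      | empty => intro W0 h _; simp at h; simp [h]
      | insert a T ha ihT =>
        intro W0 h hd
        have haW : a ∉ W0 := fun h' => by
          exact (disjoint_left.1 hd h') (mem_insert_self _ _)
        have h1 := ihT (insert a W0) (by rw [← h]; ext; simp) (by
          rw [disjoint_insert_left]
          exact ⟨ha, hd.mono_right (subset_insert _ _)⟩)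
        have hlt : #W0 < k := by
          rw [← hW]
          apply card_lt_card
          refine ⟨by rw [← h]; exact subset_union_left, fun h' => haW (h' ?_)⟩
          rw [← h]; simp
        have h2 := ih _ hlt W0 rfl a haW
        rw [card_insert_of_notMem ha, pow_succ]
        calc pr (good W0) ≤ (1 - τ)⁻¹ * pr (good (insert a W0)) := by
              rw [inv_mul_eq_div, le_div_iff₀ hpos]; linarith
          _ ≤ (1 - τ)⁻¹ * (((1 - τ)⁻¹) ^ #T * pr (good W)) := by gcongr
          _ = _ := by ring
    have h1 : pr (good W) ≤ pr (good (insert v W)) +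
        ∑ j ∈ J with v ∈ supp j, pr (Ev j) * ((1 - τ)⁻¹) ^ #(supp j) * pr (good W) := by
      -- Whatever fails at `insert v W` but not at `W` involves `v`. Of `good W` only the part away
      -- from the support of that event is kept, since that part is independent of it.
      have h2 : ∀ ω, good W ω → good (insert v W) ω ∨
          ∃ j ∈ J.filter fun j => v ∈ supp j, supp j ⊆ insert v W ∧ Ev j ω ∧
            good (W \ supp j) ω := by
        intro ω hω
        by_contra hcon
        push Not at hcon
        obtain ⟨h3, h4⟩ := hcon
        apply h3
        intro j hj hs hE
        by_cases hvj : v ∈ supp j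
        · exact h4 j (mem_filter.2 ⟨hj, hvj⟩) hs hE
            (fun j' hj' hs' => hω j' hj' (hs'.trans sdiff_subset))
        · refine hω j hj (fun u hu => ?_) hE
          rcases mem_insert.1 (hs hu) with rfl | h
          · exact absurd hu hvj
          · exact h
      refine (pr_mono h2).trans ((pr_or_le _ _).trans ?_)
      gcongr
      refine (pr_exists_le _ _).trans (sum_le_sum fun j hj => ?_)
      rw [mem_filter] at hj
      have hdet' : DeterminedBy (good (W \ supp j)) (supp j)ᶜ := by
        intro ω ω' hag hg j' hj' hs hE
        refine hg j' hj' hs (hdet j' hj' ω' ω (fun u hu => (hag u ?_).symm) hE)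
        simpa using (mem_sdiff.1 (hs hu)).2
      by_cases hs : supp j ⊆ insert v W
      · calc pr (fun ω => supp j ⊆ insert v W ∧ Ev j ω ∧ good (W \ supp j) ω)
            ≤ pr (fun ω => Ev j ω ∧ good (W \ supp j) ω) := pr_mono fun ω h => h.2
          _ = pr (Ev j) * pr (good (W \ supp j)) := pr_and_eq_mul (hdet j hj.1) hdet'
          _ ≤ pr (Ev j) * (((1 - τ)⁻¹) ^ #(W ∩ supp j) * pr (good W)) := by
              gcongr
              · exact pr_nonneg _
              · exact chain _ _ (by ext; simp; tauto)
                  (disjoint_left.2 (by intro x; simp; tauto))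
          _ ≤ pr (Ev j) * (((1 - τ)⁻¹) ^ #(supp j) * pr (good W)) := by
              gcongr
              · exact pr_nonneg _
              · exact pr_nonneg _
              · exact (one_le_inv₀ hpos).2 (by linarith)
              · exact inter_subset_right
          _ = _ := by ring
      · have : pr (fun ω => supp j ⊆ insert v W ∧ Ev j ω ∧ good (W \ supp j) ω) = 0 := by
          unfold pr; simp [hs]
        rw [this]
        have := pr_nonneg (Ev j)
        have := pr_nonneg (good W)
        positivity
    rw [← sum_mul] at h1
    have := mul_le_mul_of_nonneg_right (hsum v) (pr_nonneg (good W))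
    linarith
  have hfin : ∀ W : Finset V, 0 < pr (good W) := by
    intro W
    induction W using Finset.induction_on with
    | empty =>
      have : good ∅ = fun _ => True := by
        funext ω
        simp only [good, eq_iff_iff, iff_true]
        intro j hj hs
        exact absurd (subset_empty.1 hs) (hne j hj).ne_empty
      rw [this, pr_true]; norm_num
    | insert a W ha ih => exact lt_of_lt_of_le (mul_pos hpos ih) (step _ W rfl a ha)
  by_contra hcon
  push Not at hcon
  have h : pr (good univ) = 0 := by
    rw [pr_eq_card_div (A := ∅) (fun ω => ?_)]
    · simp
    · simp only [notMem_empty, false_iff, good, not_forall]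
      obtain ⟨j, hj, hE⟩ := hcon ω
      exact ⟨j, hj, subset_univ _, not_not.2 hE⟩
  exact (hfin univ).ne' h

end LocalLemma

/-! ### Enumerating link trees by queue exploration -/

section Exploration

variable {V : Type*}

/-- A link `(x, B, P)`: a vertex shared by an edge `B` and its parent edge `P`. -/
abbrev Link (V : Type*) := V × Finset V × Finset V

/-- The edges that occur in a set of links. -/
noncomputable def ends (Λ : Finset (Link V)) : Finset (Finset V) :=
  Λ.image (fun ℓ => ℓ.2.1) ∪ Λ.image (fun ℓ => ℓ.2.2)

/-- The union of a family of edges. -/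
noncomputable def cover (F : Finset (Finset V)) : Finset V := F.biUnion id

lemma cover_mono {F F' : Finset (Finset V)} (h : F ⊆ F') : cover F ⊆ cover F' :=
  biUnion_subset_biUnion_of_subset_left _ h

lemma card_cover_insert (E : Finset V) (F : Finset (Finset V)) :
    #(cover (insert E F)) = #(cover F) + #(E \ cover F) := by
  have : cover (insert E F) = cover F ∪ E \ cover F := by
    ext; simp [cover, or_comm]
  rw [this, card_union_of_disjoint disjoint_sdiff]

/-- The positions in an edge that are queued when the edge is discovered. -/
noncomputable def positions (E : Finset V) : List (V × Finset V) := E.toList.map fun u => (u, E)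

lemma mem_positions {E : Finset V} {u : V} : (u, E) ∈ positions E ↔ u ∈ E := by
  simp [positions]

lemma length_positions (E : Finset V) : (positions E).length = #E := by simp [positions]

/-- All sets of `k` links that a queue exploration with queue `Q` and visited edges `F`
can still discover. -/
noncomputable def discoverable (H : Finset (Finset V)) :
    ℕ → List (V × Finset V) → Finset (Finset V) → Finset (Finset (Link V))
  | 0, _, _ => {∅}
  | _ + 1, [], _ => ∅
  | k + 1, (v, A) :: Q, F => discoverable H (k + 1) Q F ∪
      (H.filter fun E => v ∈ E ∧ E ∉ F).biUnion fun E =>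
        (discoverable H k (Q ++ positions E) (insert E F)).image (insert (v, E, A)) ∪
        (discoverable H k (Q ++ positions E) (insert E F)).image (insert (v, A, E))
termination_by k Q => (k, Q.length)

lemma sum_union_le_of_nonneg {ι : Type*} [DecidableEq ι] (s t : Finset ι) (f : ι → ℝ) (hf : ∀ i, 0 ≤ f i) :
    ∑ i ∈ s ∪ t, f i ≤ ∑ i ∈ s, f i + ∑ i ∈ t, f i := by
  have := sum_union_inter (s₁ := s) (s₂ := t) (f := f)
  have h0 : 0 ≤ ∑ i ∈ s ∩ t, f i := sum_nonneg fun i _ => hf i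
  linarith

lemma sum_biUnion_le_of_nonneg {ι κ : Type*} [DecidableEq ι] (s : Finset κ) (t : κ → Finset ι) (f : ι → ℝ)
    (hf : ∀ i, 0 ≤ f i) : ∑ i ∈ s.biUnion t, f i ≤ ∑ j ∈ s, ∑ i ∈ t j, f i := by
  induction s using Finset.induction_on with
  | empty => simp
  | insert a s ha ih =>
    rw [biUnion_insert, sum_insert ha]
    exact (sum_union_le_of_nonneg _ _ _ hf).trans (by gcongr)

/-- The weight of the links found from the visited edges `F`. -/
noncomputable def weight (ρ : ℝ) (F : Finset (Finset V)) (Λ : Finset (Link V)) : ℝ :=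
  ρ ^ #(cover (F ∪ ends Λ))

lemma weight_insert_le {ρ : ℝ} (h0 : 0 ≤ ρ) (h1 : ρ ≤ 1) (E : Finset V) (F : Finset (Finset V))
    (ℓ : Link V) (hℓ : ℓ.2.1 = E ∨ ℓ.2.2 = E) (Λ : Finset (Link V)) :
    weight ρ F (insert ℓ Λ) ≤ weight ρ (insert E F) Λ := by
  apply pow_le_pow_of_le_one h0 h1
  apply card_le_card
  apply cover_mono
  intro X hX
  simp only [ends, mem_union, mem_insert, image_insert] at hX ⊢
  rcases hℓ with rfl | rfl <;> tauto

/-- A popped position finds nothing or a new edge `E`. The new edge costs `ρ ^ #(E \ cover F)`,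
which sums to at most `κ`, and a factor 2 for which end is the parent; it queues `n` further
positions. The binomial coefficient selects the productive positions among all that are ever queued,
and the recursion for it is Pascal's rule. -/
theorem sum_weight_discoverable_le (H : Finset (Finset V)) {n s : ℕ} (hn : ∀ E ∈ H, #E = n)
    {ρ κ : ℝ} (h0 : 0 ≤ ρ) (h1 : ρ ≤ 1) (hκ0 : 0 ≤ κ)
    (hκ : ∀ F ⊆ H, #F ≤ s → ∀ v, ∑ E ∈ H with v ∈ E ∧ E ∉ F, ρ ^ #(E \ cover F) ≤ κ) :
    ∀ (k : ℕ) (Q : List (V × Finset V)) (F : Finset (Finset V)), F ⊆ H → #F + k ≤ s →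
      ∑ Λ ∈ discoverable H k Q F, weight ρ F Λ ≤
        ρ ^ #(cover F) * (2 * κ) ^ k * (Q.length + k * n).choose k := by
  intro k
  induction k with
  | zero =>
    intro Q F _ _
    simp [discoverable, weight, ends]
  | succ k ihk =>
    intro Q
    induction Q with
    | nil =>
      intro F _ _
      simp only [discoverable, sum_empty]
      positivity
    | cons p Q ihQ =>
      obtain ⟨v, A⟩ := p
      intro F hF hs
      have hw : ∀ Λ, 0 ≤ weight ρ F Λ := fun Λ => pow_nonneg h0 _
      rw [discoverable]
      refine (sum_union_le_of_nonneg _ _ _ hw).trans ?_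
      have hQ := ihQ F hF hs
      have hE : ∀ E ∈ H.filter fun E => v ∈ E ∧ E ∉ F, ∀ ℓ : Link V, ℓ.2.1 = E ∨ ℓ.2.2 = E →
          ∑ Λ ∈ (discoverable H k (Q ++ positions E) (insert E F)).image (insert ℓ),
            weight ρ F Λ ≤ ρ ^ #(E \ cover F) *
              (ρ ^ #(cover F) * (2 * κ) ^ k * (Q.length + (k + 1) * n).choose k) := by
        intro E hE ℓ hℓ
        rw [mem_filter] at hE
        calc _ ≤ ∑ Λ ∈ discoverable H k (Q ++ positions E) (insert E F),
                weight ρ F (insert ℓ Λ) := sum_image_le_of_nonneg fun Λ _ => hw Λ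
          _ ≤ ∑ Λ ∈ discoverable H k (Q ++ positions E) (insert E F),
                weight ρ (insert E F) Λ := sum_le_sum fun Λ _ => weight_insert_le h0 h1 E F ℓ hℓ Λ
          _ ≤ _ := ihk _ _ (insert_subset hE.1 hF) (by
                have := card_insert_le E F
                omega)
          _ = _ := by
                rw [card_cover_insert, List.length_append, length_positions, hn E hE.1, pow_add,
                  show Q.length + n + k * n = Q.length + (k + 1) * n by ring]
                ring
      have h2 := sum_biUnion_le_of_nonneg (H.filter fun E => v ∈ E ∧ E ∉ F)
        (fun E => (discoverable H k (Q ++ positions E) (insert E F)).image (insert (v, E, A)) ∪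
        (discoverable H k (Q ++ positions E) (insert E F)).image (insert (v, A, E)))
        (weight ρ F) hw
      have h3 : ∑ E ∈ H with v ∈ E ∧ E ∉ F,
          ∑ Λ ∈ (discoverable H k (Q ++ positions E) (insert E F)).image (insert (v, E, A)) ∪
            (discoverable H k (Q ++ positions E) (insert E F)).image (insert (v, A, E)),
            weight ρ F Λ ≤ ∑ E ∈ H with v ∈ E ∧ E ∉ F, ρ ^ #(E \ cover F) *
              (2 * (ρ ^ #(cover F) * (2 * κ) ^ k * (Q.length + (k + 1) * n).choose k)) := by
        refine sum_le_sum fun E hE' => (sum_union_le_of_nonneg _ _ _ hw).trans ?_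
        have e1 := hE E hE' (v, E, A) (Or.inl rfl)
        have e2 := hE E hE' (v, A, E) (Or.inr rfl)
        linarith
      rw [← sum_mul] at h3
      have h4 := mul_le_mul_of_nonneg_right (hκ F hF (by omega) v)
        (show 0 ≤ 2 * (ρ ^ #(cover F) * (2 * κ) ^ k *
          ((Q.length + (k + 1) * n).choose k : ℝ)) by positivity)
      have h5 : (((v, A) :: Q).length + (k + 1) * n).choose (k + 1) =
          (Q.length + (k + 1) * n).choose k + (Q.length + (k + 1) * n).choose (k + 1) := by
        rw [List.length_cons, show Q.length + 1 + (k + 1) * n = (Q.length + (k + 1) * n) + 1 by ring,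
          Nat.choose_succ_succ]
      rw [h5]
      push_cast
      calc _ ≤ _ := add_le_add hQ (h2.trans (h3.trans h4))
        _ = _ := by ring

/-- The links `Λ` form a tree of edges of `H` with root `A`. -/
structure IsLinkTree (H : Finset (Finset V)) (A : Finset V) (Λ : Finset (Link V)) : Prop where
  fst_inj : ∀ ℓ ∈ Λ, ∀ ℓ' ∈ Λ, ℓ.1 = ℓ'.1 → ℓ = ℓ'
  child_inj : ∀ ℓ ∈ Λ, ∀ ℓ' ∈ Λ, ℓ.2.1 = ℓ'.2.1 → ℓ = ℓ'
  mem_child : ∀ ℓ ∈ Λ, ℓ.1 ∈ ℓ.2.1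
  mem_parent : ∀ ℓ ∈ Λ, ℓ.1 ∈ ℓ.2.2
  root_mem : A ∈ H
  child_mem : ∀ ℓ ∈ Λ, ℓ.2.1 ∈ H
  child_ne : ∀ ℓ ∈ Λ, ℓ.2.1 ≠ A
  parent_eq : ∀ ℓ ∈ Λ, ℓ.2.2 = A ∨ ∃ ℓ' ∈ Λ, ℓ'.2.1 = ℓ.2.2
  exists_rank : ∃ τ : Finset V → ℕ, ∀ ℓ ∈ Λ, τ ℓ.2.1 < τ ℓ.2.2

/-- The state of an exploration: `F` has been visited, `top` is its edge nearest to the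
root `A`, and the links in `Λ` remain to be discovered. -/
structure Exploring (H : Finset (Finset V)) (A : Finset V) (τ : Finset V → ℕ)
    (Q : List (V × Finset V)) (F : Finset (Finset V)) (top : Finset V)
    (Λ : Finset (Link V)) : Prop where
  fst_inj : ∀ ℓ ∈ Λ, ∀ ℓ' ∈ Λ, ℓ.1 = ℓ'.1 → ℓ = ℓ'
  child_inj : ∀ ℓ ∈ Λ, ∀ ℓ' ∈ Λ, ℓ.2.1 = ℓ'.2.1 → ℓ = ℓ'
  mem_child : ∀ ℓ ∈ Λ, ℓ.1 ∈ ℓ.2.1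
  mem_parent : ∀ ℓ ∈ Λ, ℓ.1 ∈ ℓ.2.2
  child_mem : ∀ ℓ ∈ Λ, ℓ.2.1 ∈ H
  parent_mem : ∀ ℓ ∈ Λ, ℓ.2.2 ∈ H
  rank_lt : ∀ ℓ ∈ Λ, τ ℓ.2.1 < τ ℓ.2.2
  top_mem : top ∈ F
  rank_le : ∀ E ∈ F, τ E ≤ τ top
  child_eq_top : ∀ ℓ ∈ Λ, ℓ.2.1 ∈ F → ℓ.2.1 = top
  parent_eq : ∀ ℓ ∈ Λ, ℓ.2.2 = A ∨ ℓ.2.2 ∈ F ∨ ∃ ℓ' ∈ Λ, ℓ'.2.1 = ℓ.2.2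
  root : A ∈ F ∨ ∃ ℓ ∈ Λ, ℓ.2.1 = top
  queue_parent : ∀ ℓ ∈ Λ, ℓ.2.2 ∈ F → (ℓ.1, ℓ.2.2) ∈ Q
  queue_child : ∀ ℓ ∈ Λ, ℓ.2.1 ∈ F → (ℓ.1, ℓ.2.1) ∈ Q

variable {H : Finset (Finset V)} {A : Finset V} {τ : Finset V → ℕ}

/-- If the root is visited, a remaining link of maximal parent rank has a visited parent; otherwise
a link leading up from `top` remains. In both cases a position would still be queued. -/
lemma Exploring.eq_empty {F : Finset (Finset V)} {top : Finset V} {Λ : Finset (Link V)}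
    (h : Exploring H A τ [] F top Λ) : Λ = ∅ := by
  by_contra hne
  obtain ⟨ℓ, hℓ, hmax⟩ := exists_max_image Λ (fun ℓ => τ ℓ.2.2) (nonempty_iff_ne_empty.2 hne)
  have hA : A ∉ F := by
    intro hA
    rcases h.parent_eq ℓ hℓ with h1 | h1 | ⟨ℓ', hℓ', h1⟩
    · exact absurd (h.queue_parent ℓ hℓ (h1 ▸ hA)) (by simp)
    · exact absurd (h.queue_parent ℓ hℓ h1) (by simp)
    · have := h.rank_lt ℓ' hℓ'
      have := hmax ℓ' hℓ'
      rw [h1] at *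
      omega
  rcases h.root with h1 | ⟨ℓ', hℓ', h1⟩
  · exact hA h1
  · exact absurd (h.queue_child ℓ' hℓ' (h1 ▸ h.top_mem)) (by simp)

/-- A visited child would be `top`, of maximal rank in `F`, yet it ranks below its visited parent.
-/
lemma Exploring.child_notMem {Q : List (V × Finset V)} {F : Finset (Finset V)} {top : Finset V}
    {Λ : Finset (Link V)} (h : Exploring H A τ Q F top Λ) {ℓ : Link V} (hℓ : ℓ ∈ Λ)
    (hP : ℓ.2.2 ∈ F) : ℓ.2.1 ∉ F := fun hB => by
  have h1 := h.rank_lt ℓ hℓ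
  have h2 := h.rank_le _ hP
  rw [h.child_eq_top ℓ hℓ hB] at h1
  omega

/-- Discovery downwards leaves `top` in place. Links have distinct vertices, so the popped position
serves no other link and may be dropped. -/
lemma Exploring.step_child {v : V} {E : Finset V} {Q : List (V × Finset V)}
    {F : Finset (Finset V)} {top : Finset V} {Λ : Finset (Link V)}
    (h : Exploring H A τ ((v, E) :: Q) F top Λ) {ℓ : Link V} (hℓ : ℓ ∈ Λ) (hv : ℓ.1 = v)
    (hE : ℓ.2.2 = E) (hEF : E ∈ F) :
    Exploring H A τ (Q ++ positions ℓ.2.1) (insert ℓ.2.1 F) top (Λ.erase ℓ) := by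
  have hB : ℓ.2.1 ∉ F := h.child_notMem hℓ (hE ▸ hEF)
  have hsub : ∀ {ℓ'}, ℓ' ∈ Λ.erase ℓ → ℓ' ∈ Λ := fun h => mem_of_mem_erase h
  have hchild : ∀ ℓ' ∈ Λ.erase ℓ, ℓ'.2.1 ≠ ℓ.2.1 := fun ℓ' h' heq =>
    (mem_erase.1 h').1 (h.child_inj _ (hsub h') _ hℓ heq)
  have hfst : ∀ ℓ' ∈ Λ.erase ℓ, ∀ X, (ℓ'.1, X) ∈ (v, E) :: Q → (ℓ'.1, X) ∈ Q := by
    intro ℓ' h' X hX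
    rcases List.mem_cons.1 hX with hX | hX
    · exact absurd (h.fst_inj _ (hsub h') _ hℓ ((Prod.ext_iff.1 hX).1.trans hv.symm))
        (mem_erase.1 h').1
    · exact hX
  refine ⟨fun a ha c hc => h.fst_inj a (hsub ha) c (hsub hc),
    fun a ha c hc => h.child_inj a (hsub ha) c (hsub hc), fun a ha => h.mem_child a (hsub ha),
    fun a ha => h.mem_parent a (hsub ha), fun a ha => h.child_mem a (hsub ha),
    fun a ha => h.parent_mem a (hsub ha), fun a ha => h.rank_lt a (hsub ha),
    mem_insert_of_mem h.top_mem, ?_, ?_, ?_, ?_, ?_, ?_⟩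
  · intro X hX
    rcases mem_insert.1 hX with rfl | hX
    · exact (h.rank_lt ℓ hℓ).le.trans (h.rank_le _ (hE ▸ hEF))
    · exact h.rank_le X hX
  · intro ℓ' h' hX
    exact h.child_eq_top ℓ' (hsub h') ((mem_insert.1 hX).resolve_left (hchild ℓ' h'))
  · intro ℓ' h'
    rcases h.parent_eq ℓ' (hsub h') with h1 | h1 | ⟨a, ha, h1⟩
    · exact Or.inl h1
    · exact Or.inr (Or.inl (mem_insert_of_mem h1))
    · by_cases hal : a = ℓ
      · subst hal; exact Or.inr (Or.inl (by rw [h1]; exact mem_insert_self _ _))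
      · exact Or.inr (Or.inr ⟨a, mem_erase.2 ⟨hal, ha⟩, h1⟩)
  · rcases h.root with h1 | ⟨a, ha, h1⟩
    · exact Or.inl (mem_insert_of_mem h1)
    · refine Or.inr ⟨a, mem_erase.2 ⟨?_, ha⟩, h1⟩
      rintro rfl
      exact hB (h1 ▸ h.top_mem)
  · intro ℓ' h' hX
    rcases mem_insert.1 hX with hX | hX
    · refine List.mem_append.2 (Or.inr ?_)
      rw [hX, mem_positions, ← hX]
      exact h.mem_parent _ (hsub h')
    · exact List.mem_append.2 (Or.inl (hfst ℓ' h' _ (h.queue_parent _ (hsub h') hX)))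
  · intro ℓ' h' hX
    have hX := (mem_insert.1 hX).resolve_left (hchild ℓ' h')
    exact List.mem_append.2 (Or.inl (hfst ℓ' h' _ (h.queue_child _ (hsub h') hX)))

lemma Exploring.parent_notMem {Q : List (V × Finset V)} {F : Finset (Finset V)} {top : Finset V}
    {Λ : Finset (Link V)} (h : Exploring H A τ Q F top Λ) {ℓ : Link V} (hℓ : ℓ ∈ Λ)
    (hB : ℓ.2.1 ∈ F) : ℓ.2.2 ∉ F := fun hP => h.child_notMem hℓ hP hB

/-- Discovery upwards makes the parent the new `top`. No other remaining link has a child in the old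
`F`: that child could only be the old `top`, and children determine links. -/
lemma Exploring.step_parent {v : V} {E : Finset V} {Q : List (V × Finset V)}
    {F : Finset (Finset V)} {top : Finset V} {Λ : Finset (Link V)}
    (h : Exploring H A τ ((v, E) :: Q) F top Λ) {ℓ : Link V} (hℓ : ℓ ∈ Λ) (hv : ℓ.1 = v)
    (hE : ℓ.2.1 = E) (hEF : E ∈ F) :
    Exploring H A τ (Q ++ positions ℓ.2.2) (insert ℓ.2.2 F) ℓ.2.2 (Λ.erase ℓ) := by
  have htop : ℓ.2.1 = top := h.child_eq_top ℓ hℓ (hE ▸ hEF)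
  have hP : ℓ.2.2 ∉ F := h.parent_notMem hℓ (hE ▸ hEF)
  have hsub : ∀ {ℓ'}, ℓ' ∈ Λ.erase ℓ → ℓ' ∈ Λ := fun h => mem_of_mem_erase h
  have hchild : ∀ ℓ' ∈ Λ.erase ℓ, ℓ'.2.1 ≠ ℓ.2.1 := fun ℓ' h' heq =>
    (mem_erase.1 h').1 (h.child_inj _ (hsub h') _ hℓ heq)
  have hfst : ∀ ℓ' ∈ Λ.erase ℓ, ∀ X, (ℓ'.1, X) ∈ (v, E) :: Q → (ℓ'.1, X) ∈ Q := by
    intro ℓ' h' X hX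
    rcases List.mem_cons.1 hX with hX | hX
    · exact absurd (h.fst_inj _ (hsub h') _ hℓ ((Prod.ext_iff.1 hX).1.trans hv.symm))
        (mem_erase.1 h').1
    · exact hX
  have hrank := h.rank_lt ℓ hℓ
  have hF : ∀ ℓ' ∈ Λ.erase ℓ, ℓ'.2.1 ∉ F := fun ℓ' h' hX =>
    hchild ℓ' h' ((h.child_eq_top ℓ' (hsub h') hX).trans htop.symm)
  refine ⟨fun a ha c hc => h.fst_inj a (hsub ha) c (hsub hc),
    fun a ha c hc => h.child_inj a (hsub ha) c (hsub hc), fun a ha => h.mem_child a (hsub ha),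
    fun a ha => h.mem_parent a (hsub ha), fun a ha => h.child_mem a (hsub ha),
    fun a ha => h.parent_mem a (hsub ha), fun a ha => h.rank_lt a (hsub ha),
    mem_insert_self _ _, ?_, ?_, ?_, ?_, ?_, ?_⟩
  · intro X hX
    rcases mem_insert.1 hX with rfl | hX
    · exact le_rfl
    · have := h.rank_le X hX
      rw [htop] at hrank
      omega
  · intro ℓ' h' hX
    exact (mem_insert.1 hX).resolve_right (hF ℓ' h')
  · intro ℓ' h'
    rcases h.parent_eq ℓ' (hsub h') with h1 | h1 | ⟨a, ha, h1⟩
    · exact Or.inl h1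
    · exact Or.inr (Or.inl (mem_insert_of_mem h1))
    · by_cases hal : a = ℓ
      · subst hal; exact Or.inr (Or.inl (by rw [← h1, htop]; exact mem_insert_of_mem h.top_mem))
      · exact Or.inr (Or.inr ⟨a, mem_erase.2 ⟨hal, ha⟩, h1⟩)
  · rcases h.parent_eq ℓ hℓ with h1 | h1 | ⟨a, ha, h1⟩
    · exact Or.inl (by rw [← h1]; exact mem_insert_self _ _)
    · exact absurd h1 hP
    · refine Or.inr ⟨a, mem_erase.2 ⟨?_, ha⟩, h1⟩
      rintro rfl
      rw [h1] at hrank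
      omega
  · intro ℓ' h' hX
    rcases mem_insert.1 hX with hX | hX
    · refine List.mem_append.2 (Or.inr ?_)
      rw [hX, mem_positions, ← hX]
      exact h.mem_parent _ (hsub h')
    · exact List.mem_append.2 (Or.inl (hfst ℓ' h' _ (h.queue_parent _ (hsub h') hX)))
  · intro ℓ' h' hX
    rcases mem_insert.1 hX with hX | hX
    · refine List.mem_append.2 (Or.inr ?_)
      rw [hX, mem_positions, ← hX]
      exact h.mem_child _ (hsub h')
    · exact absurd hX (hF ℓ' h')

lemma Exploring.skip {v : V} {E : Finset V} {Q : List (V × Finset V)}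
    {F : Finset (Finset V)} {top : Finset V} {Λ : Finset (Link V)}
    (h : Exploring H A τ ((v, E) :: Q) F top Λ)
    (hno : ∀ ℓ ∈ Λ, ℓ.1 = v → ¬ ((ℓ.2.1 = E ∨ ℓ.2.2 = E) ∧ E ∈ F)) :
    Exploring H A τ Q F top Λ := by
  refine { h with queue_parent := ?_, queue_child := ?_ }
  · intro ℓ hℓ hX
    rcases List.mem_cons.1 (h.queue_parent ℓ hℓ hX) with h1 | h1
    · obtain ⟨e1, e2⟩ := Prod.mk.injEq .. ▸ h1
      exact absurd ⟨Or.inr e2, e2 ▸ hX⟩ (hno ℓ hℓ e1)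
    · exact h1
  · intro ℓ hℓ hX
    rcases List.mem_cons.1 (h.queue_child ℓ hℓ hX) with h1 | h1
    · obtain ⟨e1, e2⟩ := Prod.mk.injEq .. ▸ h1
      exact absurd ⟨Or.inl e2, e2 ▸ hX⟩ (hno ℓ hℓ e1)
    · exact h1

theorem Exploring.mem_discoverable : ∀ (k : ℕ) (Q : List (V × Finset V)) (F : Finset (Finset V))
    (top : Finset V) (Λ : Finset (Link V)), #Λ = k → Exploring H A τ Q F top Λ →
    Λ ∈ discoverable H k Q F := by
  intro k
  induction k with
  | zero =>
    intro Q F top Λ hk _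
    simpa [discoverable] using hk
  | succ k ihk =>
    intro Q
    induction Q with
    | nil =>
      intro F top Λ hk h
      rw [h.eq_empty] at hk
      simp at hk
    | cons p Q ihQ =>
      obtain ⟨v, E⟩ := p
      intro F top Λ hk h
      rw [discoverable]
      by_cases hno : ∀ ℓ ∈ Λ, ℓ.1 = v → ¬ ((ℓ.2.1 = E ∨ ℓ.2.2 = E) ∧ E ∈ F)
      · exact mem_union_left _ (ihQ F top Λ hk (h.skip hno))
      · push Not at hno
        obtain ⟨ℓ, hℓ, hv, hE, hEF⟩ := hno
        have hcard : #(Λ.erase ℓ) = k := by rw [card_erase_of_mem hℓ]; omega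
        apply mem_union_right
        rw [mem_biUnion]
        rcases hE with hE | hE
        · refine ⟨ℓ.2.2, mem_filter.2 ⟨h.parent_mem ℓ hℓ, hv ▸ h.mem_parent ℓ hℓ,
            h.parent_notMem hℓ (hE ▸ hEF)⟩, mem_union_right _ (mem_image.2 ⟨Λ.erase ℓ,
            ihk _ _ _ _ hcard (h.step_parent hℓ hv hE hEF), ?_⟩)⟩
          rw [← hv, ← hE]
          exact insert_erase hℓ
        · refine ⟨ℓ.2.1, mem_filter.2 ⟨h.child_mem ℓ hℓ, hv ▸ h.mem_child ℓ hℓ,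
            h.child_notMem hℓ (hE ▸ hEF)⟩, mem_union_left _ (mem_image.2 ⟨Λ.erase ℓ,
            ihk _ _ _ _ hcard (h.step_child hℓ hv hE hEF), ?_⟩)⟩
          rw [← hv, ← hE]
          exact insert_erase hℓ

/-- The edges of a link tree with root `A`. -/
noncomputable def treeEdges (A : Finset V) (Λ : Finset (Link V)) : Finset (Finset V) :=
  insert A (Λ.image fun ℓ => ℓ.2.1)

lemma IsLinkTree.ends_subset {Λ : Finset (Link V)} (h : IsLinkTree H A Λ) :
    ends Λ ⊆ treeEdges A Λ := by
  intro X hX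
  simp only [ends, treeEdges, mem_union, mem_image, mem_insert] at hX ⊢
  rcases hX with hX | ⟨ℓ, hℓ, rfl⟩
  · exact Or.inr hX
  · exact h.parent_eq ℓ hℓ

lemma IsLinkTree.treeEdges_subset {Λ : Finset (Link V)} (h : IsLinkTree H A Λ) :
    treeEdges A Λ ⊆ H := by
  intro X hX
  simp only [treeEdges, mem_image, mem_insert] at hX
  rcases hX with rfl | ⟨ℓ, hℓ, rfl⟩
  · exact h.root_mem
  · exact h.child_mem ℓ hℓ

/-- The exploration may enter the tree at any edge, not only at the root, so trees can be counted
from an edge through a prescribed vertex. -/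
theorem IsLinkTree.mem_discoverable {Λ : Finset (Link V)} (h : IsLinkTree H A Λ) {E : Finset V}
    (hE : E ∈ treeEdges A Λ) : Λ ∈ discoverable H #Λ (positions E) {E} := by
  obtain ⟨τ, hτ⟩ := h.exists_rank
  refine Exploring.mem_discoverable (A := A) (τ := τ) #Λ (positions E) {E} E Λ rfl
    ⟨h.fst_inj, h.child_inj, h.mem_child, h.mem_parent, h.child_mem,
    fun ℓ hℓ => h.treeEdges_subset (h.ends_subset ?_), hτ, mem_singleton_self _, ?_, ?_, ?_, ?_,
    ?_, ?_⟩
  · exact mem_union_right _ (mem_image_of_mem _ hℓ)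
  · intro X hX; rw [mem_singleton.1 hX]
  · intro ℓ _ hX; exact mem_singleton.1 hX
  · intro ℓ hℓ
    rcases h.parent_eq ℓ hℓ with h1 | h1
    · exact Or.inl h1
    · exact Or.inr (Or.inr h1)
  · simp only [treeEdges, mem_image, mem_insert] at hE
    rcases hE with rfl | h1
    · exact Or.inl (mem_singleton_self _)
    · exact Or.inr h1
  · intro ℓ hℓ hX
    have hX := mem_singleton.1 hX
    rw [hX, mem_positions, ← hX]
    exact h.mem_parent ℓ hℓ
  · intro ℓ hℓ hX
    have hX := mem_singleton.1 hX
    rw [hX, mem_positions, ← hX]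
    exact h.mem_child ℓ hℓ

end Exploration

/-! ### Number and probability of link trees -/

section TreeBounds

variable {V : Type*} {H : Finset (Finset V)}

lemma IsLinkTree.exists_parent_eq_root {A : Finset V} {Λ : Finset (Link V)}
    (h : IsLinkTree H A Λ) (hne : Λ.Nonempty) : ∃ ℓ ∈ Λ, ℓ.2.2 = A := by
  obtain ⟨τ, hτ⟩ := h.exists_rank
  obtain ⟨ℓ, hℓ, hmax⟩ := exists_max_image Λ (fun ℓ => τ ℓ.2.2) hne
  rcases h.parent_eq ℓ hℓ with h1 | ⟨ℓ', hℓ', h1⟩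
  · exact ⟨ℓ, hℓ, h1⟩
  · have h2 := hτ ℓ' hℓ'
    have h3 := hmax ℓ' hℓ'
    rw [h1] at h2
    omega

/-- The root is the only parent that is not a child, or the given edge if there are no links. Hence
a start edge and the links determine the tree, and the count in `sum_trees_le` is injective. -/
lemma IsLinkTree.root_unique {A A' E : Finset V} {Λ : Finset (Link V)}
    (h : IsLinkTree H A Λ) (h' : IsLinkTree H A' Λ) (hE : E ∈ treeEdges A Λ)
    (hE' : E ∈ treeEdges A' Λ) : A = A' := by
  rcases Λ.eq_empty_or_nonempty with rfl | hne
  · simp only [treeEdges, image_empty, mem_insert, notMem_empty, or_false] at hE hE'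
    exact hE.symm.trans hE'
  · obtain ⟨ℓ, hℓ, h1⟩ := h.exists_parent_eq_root hne
    rcases h'.parent_eq ℓ hℓ with h2 | ⟨ℓ', hℓ', h2⟩
    · exact h1.symm.trans h2
    · exact absurd (h2.trans h1) (h.child_ne ℓ' hℓ')

/-- The total weight of the link trees with `m` links that cover a given vertex. -/
theorem sum_trees_le {n s m : ℕ} (hn : ∀ E ∈ H, #E = n) {ρ κ : ℝ} (h0 : 0 ≤ ρ) (h1 : ρ ≤ 1)
    (hκ : ∀ F ⊆ H, #F ≤ s → ∀ v, ∑ E ∈ H with v ∈ E ∧ E ∉ F, ρ ^ #(E \ cover F) ≤ κ)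
    (hm : m + 1 ≤ s) (v : V) (𝒯 : Finset (Finset V × Finset (Link V)))
    (h𝒯 : ∀ T ∈ 𝒯, IsLinkTree H T.1 T.2 ∧ #T.2 = m ∧ v ∈ cover (treeEdges T.1 T.2)) :
    ∑ T ∈ 𝒯, ρ ^ #(cover (treeEdges T.1 T.2)) ≤
      κ * (2 * κ) ^ m * (((m + 1) * n).choose m : ℝ) := by
  have hκ' := hκ ∅ (empty_subset _) (by simp) v
  simp only [notMem_empty, not_false_eq_true, and_true] at hκ'
  have hκ0 : 0 ≤ κ := le_trans (sum_nonneg fun i _ => pow_nonneg h0 _) hκ'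
  have hch : ∀ T : Finset V × Finset (Link V), ∃ E, T ∈ 𝒯 → E ∈ treeEdges T.1 T.2 ∧ v ∈ E := by
    intro T
    by_cases hT : T ∈ 𝒯
    · have := (h𝒯 T hT).2.2
      simp only [cover, mem_biUnion, id] at this
      obtain ⟨E, hE, hv⟩ := this
      exact ⟨E, fun _ => ⟨hE, hv⟩⟩
    · exact ⟨∅, fun h => absurd h hT⟩
  choose e he using hch
  calc ∑ T ∈ 𝒯, ρ ^ #(cover (treeEdges T.1 T.2))
      ≤ ∑ T ∈ 𝒯, weight ρ {e T} T.2 := by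
        refine sum_le_sum fun T hT => pow_le_pow_of_le_one h0 h1 (card_le_card (cover_mono ?_))
        exact union_subset (singleton_subset_iff.2 (he T hT).1) (h𝒯 T hT).1.ends_subset
    _ = ∑ p ∈ 𝒯.image (fun T => (⟨e T, T.2⟩ : Σ _ : Finset V, Finset (Link V))),
          weight ρ {p.1} p.2 := by
        rw [sum_image]
        intro T hT T' hT' heq
        simp only [Sigma.mk.injEq, heq_eq_eq] at heq
        obtain ⟨e1, e2⟩ := heq
        refine Prod.ext ?_ e2
        refine (h𝒯 T hT).1.root_unique (e2 ▸ (h𝒯 T' hT').1) (he T hT).1 ?_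
        rw [e1, e2]
        exact (he T' hT').1
    _ ≤ ∑ p ∈ (H.filter fun E => v ∈ E).sigma fun E => discoverable H m (positions E) {E},
          weight ρ {p.1} p.2 := by
        refine sum_le_sum_of_subset_of_nonneg ?_ fun p _ _ => pow_nonneg h0 _
        intro p hp
        obtain ⟨T, hT, rfl⟩ := mem_image.1 hp
        obtain ⟨hl, hm', -⟩ := h𝒯 T hT
        refine mem_sigma.2 ⟨mem_filter.2 ⟨hl.treeEdges_subset (he T hT).1, (he T hT).2⟩, ?_⟩
        have := hl.mem_discoverable (he T hT).1
        rwa [hm'] at this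
    _ = ∑ E ∈ H with v ∈ E, ∑ Λ ∈ discoverable H m (positions E) {E}, weight ρ {E} Λ :=
        sum_sigma _ _ _
    _ ≤ ∑ E ∈ H with v ∈ E, ρ ^ #(E \ cover ∅) *
          ((2 * κ) ^ m * (((m + 1) * n).choose m : ℝ)) := by
        refine sum_le_sum fun E hE => ?_
        rw [mem_filter] at hE
        have := sum_weight_discoverable_le H hn h0 h1 hκ0 hκ m (positions E) {E}
          (singleton_subset_iff.2 hE.1) (by simpa [add_comm] using hm)
        rw [length_positions, hn E hE.1] at this
        refine this.trans (le_of_eq ?_)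
        simp only [cover, singleton_biUnion, id, biUnion_empty, sdiff_empty]
        rw [show n + m * n = (m + 1) * n by ring, mul_assoc]
    _ ≤ _ := by
        rw [← sum_mul, mul_assoc]
        gcongr

lemma mem_cover_of_mem_root {A : Finset V} {Λ : Finset (Link V)} {u : V} (hu : u ∈ A) :
    u ∈ cover (treeEdges A Λ) :=
  mem_biUnion.2 ⟨A, mem_insert_self _ _, hu⟩

lemma mem_cover_of_mem_child {A : Finset V} {Λ : Finset (Link V)} {u : V} {ℓ : Link V}
    (hℓ : ℓ ∈ Λ) (hu : u ∈ ℓ.2.1) : u ∈ cover (treeEdges A Λ) :=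
  mem_biUnion.2 ⟨ℓ.2.1, mem_insert_of_mem (mem_image_of_mem _ hℓ), hu⟩

/-- The vertices of the links. -/
noncomputable def linkVertices (Λ : Finset (Link V)) : Finset V := Λ.image Prod.fst

/-- At most `#Λ` vertices of the child edge are link vertices, at most `b` lie in the root, and at
most `b` in each of the `#Λ - 1` other child edges. -/
lemma IsLinkTree.card_private_ge {n b : ℕ} {A : Finset V} {Λ : Finset (Link V)}
    (h : IsLinkTree H A Λ) (hn : ∀ E ∈ H, #E = n)
    (hb : ∀ E ∈ H, ∀ F ∈ H, E ≠ F → #(E ∩ F) ≤ b) {ℓ : Link V} (hℓ : ℓ ∈ Λ) :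
    n - (b + 1) * #Λ ≤
      #{u ∈ ℓ.2.1 | u ∉ linkVertices Λ ∧ u ∉ A ∧ ∀ ℓ' ∈ Λ, ℓ' ≠ ℓ → u ∉ ℓ'.2.1} := by
  set W := {u ∈ ℓ.2.1 | u ∉ linkVertices Λ ∧ u ∉ A ∧ ∀ ℓ' ∈ Λ, ℓ' ≠ ℓ → u ∉ ℓ'.2.1} with hW
  have hsub : ℓ.2.1 ⊆ W ∪ (linkVertices Λ ∪ (ℓ.2.1 ∩ A ∪
      (Λ.erase ℓ).biUnion fun ℓ' => ℓ.2.1 ∩ ℓ'.2.1)) := by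
    intro u hu
    by_cases hX : u ∈ linkVertices Λ
    · simp [hX]
    by_cases hA : u ∈ A
    · simp [hA, hu]
    by_cases hB : ∀ ℓ' ∈ Λ, ℓ' ≠ ℓ → u ∉ ℓ'.2.1
    · exact mem_union_left _ (mem_filter.2 ⟨hu, hX, hA, hB⟩)
    · push Not at hB
      obtain ⟨ℓ', h1, h2, h3⟩ := hB
      refine mem_union_right _ (mem_union_right _ (mem_union_right _ (mem_biUnion.2 ?_)))
      exact ⟨ℓ', mem_erase.2 ⟨h2, h1⟩, mem_inter.2 ⟨hu, h3⟩⟩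
  have hc := (card_le_card hsub).trans ((card_union_le _ _).trans
    (Nat.add_le_add_left ((card_union_le _ _).trans
      (Nat.add_le_add_left (card_union_le _ _) _)) _))
  have h1 : #(linkVertices Λ) ≤ #Λ := card_image_le
  have h2 := hb ℓ.2.1 (h.child_mem ℓ hℓ) A h.root_mem (h.child_ne ℓ hℓ)
  have h3 : #((Λ.erase ℓ).biUnion fun ℓ' => ℓ.2.1 ∩ ℓ'.2.1) ≤ #(Λ.erase ℓ) * b := by
    apply card_biUnion_le_card_mul
    intro ℓ' h'
    obtain ⟨h4, h5⟩ := mem_erase.1 h'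
    exact hb _ (h.child_mem ℓ hℓ) _ (h.child_mem ℓ' h5)
      fun he => h4 (h.child_inj _ h5 _ hℓ he.symm)
  rw [card_erase_of_mem hℓ] at h3
  have h4 : 1 ≤ #Λ := card_pos.2 ⟨ℓ, hℓ⟩
  obtain ⟨m, hm⟩ := Nat.exists_eq_add_of_le h4
  rw [hn _ (h.child_mem ℓ hℓ)] at hc
  rw [hm] at h3 h1 ⊢
  rw [show 1 + m - 1 = m by omega] at h3
  have : (b + 1) * (1 + m) = (1 + m) + b + m * b := by ring
  rw [tsub_le_iff_right, this]
  omega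

variable {r n : ℕ}

/-- The coloring event of a link tree: every vertex of the root lies in one of the sets `G i`,
and the other vertices agree with the links that own their edges. -/
def TreeEvent (G : Fin r → Finset (Fin r × Fin n)) (A : Finset V) (Λ : Finset (Link V))
    (ω : V → Fin r × Fin n) : Prop :=
  (∃ i, ∀ u ∈ A, u ∉ linkVertices Λ → ω u ∈ G i) ∧
    ∀ ℓ ∈ Λ, ∀ u ∈ ℓ.2.1, u ∉ linkVertices Λ → u ∉ A →
      (ω u).1 = (ω ℓ.1).1 ∧ (ω ℓ.1).2 ≤ (ω u).2

lemma IsLinkTree.determinedBy {A : Finset V} {Λ : Finset (Link V)} (h : IsLinkTree H A Λ)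
    (G : Fin r → Finset (Fin r × Fin n)) :
    DeterminedBy (TreeEvent G A Λ) (cover (treeEdges A Λ)) := by
  rintro ω ω' hag ⟨⟨i, h1⟩, h2⟩
  refine ⟨⟨i, fun u hu hX => ?_⟩, fun ℓ hℓ u hu hX hA => ?_⟩
  · rw [← hag u (mem_cover_of_mem_root hu)]
    exact h1 u hu hX
  · rw [← hag u (mem_cover_of_mem_child hℓ hu),
      ← hag ℓ.1 (mem_cover_of_mem_child hℓ (h.mem_child ℓ hℓ))]
    exact h2 ℓ hℓ u hu hX hA

/-- Union bound over the index `i` of the root and the values `ξ` at the link vertices. Once these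
are fixed, the vertices are independent: a link vertex contributes `1 / (r * n)`, another root
vertex at most `g / r`, and any remaining vertex `(1 / r) * (1 - y / n)`, where `y` is the level at
the link assigned to it. By `card_private_ge` every link is assigned at least `n - (b + 1) * #Λ`
vertices. -/
theorem pr_treeEvent_le [Fintype V] {b : ℕ} {A : Finset V} {Λ : Finset (Link V)} (hr : 0 < r) (hn0 : 0 < n)
    (h : IsLinkTree H A Λ) (hn : ∀ E ∈ H, #E = n)
    (hb : ∀ E ∈ H, ∀ F ∈ H, E ≠ F → #(E ∩ F) ≤ b)
    (G : Fin r → Finset (Fin r × Fin n)) {g : ℝ} (hG : ∀ i, (#(G i) : ℝ) ≤ n * g) :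
    pr (TreeEvent G A Λ) ≤ r * (1 / r : ℝ) ^ #(cover (treeEdges A Λ)) *
      ((r : ℝ) / n * ∑ y : Fin n, (1 - (y : ℝ) / n) ^ (n - (b + 1) * #Λ)) ^ #Λ *
      g ^ #(A \ linkVertices Λ) := by
  have hr' : (0 : ℝ) < r := by exact_mod_cast hr
  have hn' : (0 : ℝ) < n := by exact_mod_cast hn0
  have : Nonempty (Fin r × Fin n) := ⟨(⟨0, hr⟩, ⟨0, hn0⟩)⟩
  have hg : 0 ≤ g := by
    have := (Nat.cast_nonneg _).trans (hG ⟨0, hr⟩)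
    exact nonneg_of_mul_nonneg_right this hn'
  let s0 : Fin r × Fin n := (⟨0, hr⟩, ⟨0, hn0⟩)
  set X := linkVertices Λ with hX
  set U := cover (treeEdges A Λ) with hU
  have hAU : A ⊆ U := fun u hu => mem_cover_of_mem_root hu
  have hXU : X ⊆ U := by
    intro u hu
    obtain ⟨ℓ, hℓ, rfl⟩ := mem_image.1 hu
    exact mem_cover_of_mem_child hℓ (h.mem_child ℓ hℓ)
  have hcardX : #X = #Λ := card_image_of_injOn fun ℓ hℓ ℓ' hℓ' he => h.fst_inj ℓ hℓ ℓ' hℓ' he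
  have hch : ∀ u : V, ∃ ℓ : Link V, (u ∈ X → ℓ ∈ Λ ∧ ℓ.1 = u) ∧
      (u ∈ U → u ∉ X → u ∉ A → ℓ ∈ Λ ∧ u ∈ ℓ.2.1) := by
    intro u
    by_cases h1 : u ∈ X
    · obtain ⟨ℓ, hℓ, he⟩ := mem_image.1 h1
      exact ⟨ℓ, fun _ => ⟨hℓ, he⟩, fun _ h2 => absurd h1 h2⟩
    · by_cases h2 : u ∈ U ∧ u ∉ A
      · obtain ⟨E, hE, hu⟩ := mem_biUnion.1 h2.1
        simp only [treeEdges, mem_insert, mem_image] at hE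
        rcases hE with rfl | ⟨ℓ, hℓ, rfl⟩
        · exact absurd hu h2.2
        · exact ⟨ℓ, fun h => absurd h h1, fun _ _ _ => ⟨hℓ, hu⟩⟩
      · exact ⟨(u, ∅, ∅), fun h => absurd h h1, fun h3 _ h4 => absurd ⟨h3, h4⟩ h2⟩
  choose a ha1 ha2 using hch
  let W := (U \ X) \ A
  -- Links outside `Λ` take the dummy value `s0`, so a sum over `Ξ` is a sum over the values at `Λ`.
  let Ξ : Finset (Link V → Fin r × Fin n) :=
    Fintype.piFinset fun ℓ => if ℓ ∈ Λ then univ else {s0}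
  let C : Fin r → (Link V → Fin r × Fin n) → V → Finset (Fin r × Fin n) := fun i ξ u =>
    if u ∈ X then {ξ (a u)} else if u ∈ A then G i else if u ∈ U then
      {(ξ (a u)).1} ×ˢ Ici (ξ (a u)).2 else univ
  have hcover : ∀ ω, TreeEvent G A Λ ω → ∃ i ∈ (univ : Finset (Fin r)), ∃ ξ ∈ Ξ,
      ∀ u, ω u ∈ C i ξ u := by
    rintro ω ⟨⟨i, h1⟩, h2⟩
    refine ⟨i, mem_univ _, fun ℓ => if ℓ ∈ Λ then ω ℓ.1 else s0, ?_, ?_⟩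
    · rw [Fintype.mem_piFinset]
      intro ℓ
      by_cases hℓ : ℓ ∈ Λ <;> simp [hℓ]
    · intro u
      simp only [C]
      split_ifs with c1 c2 c3 c4 c5
      · rw [(ha1 u c1).2]; exact mem_singleton_self _
      · exact absurd (ha1 u c1).1 c2
      · exact h1 u c3 c1
      · have := h2 _ c5 u (ha2 u c4 c1 c3).2 c1 c3
        exact mem_product.2 ⟨mem_singleton.2 this.1, mem_Ici.2 this.2⟩
      · exact absurd (ha2 u c4 c1 c3).1 c5
      · exact mem_univ _
  have hfiber : ∀ ℓ ∈ Λ, n - (b + 1) * #Λ ≤ #{u ∈ W | a u = ℓ} := by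
    intro ℓ hℓ
    refine (h.card_private_ge hn hb hℓ).trans (card_le_card ?_)
    intro u hu
    obtain ⟨h1, h2, h3, h4⟩ := mem_filter.1 hu
    have h5 : u ∈ U := mem_cover_of_mem_child hℓ h1
    refine mem_filter.2 ⟨mem_sdiff.2 ⟨mem_sdiff.2 ⟨h5, h2⟩, h3⟩, ?_⟩
    obtain ⟨h6, h7⟩ := ha2 u h5 h2 h3
    by_contra hne
    exact h4 _ h6 hne h7
  have hfac : ∀ y : Fin n, 0 ≤ 1 - (y : ℝ) / n ∧ 1 - (y : ℝ) / n ≤ 1 := by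
    intro y
    have : (y : ℝ) / n ≤ 1 := by
      rw [div_le_one hn']
      exact_mod_cast y.2.le
    exact ⟨by linarith, by linarith [show 0 ≤ (y : ℝ) / n by positivity]⟩
  have hbox : ∀ i, ∀ ξ ∈ Ξ, pr (fun ω => ∀ u, ω u ∈ C i ξ u) ≤
      (1 / r : ℝ) ^ #U * (1 / n : ℝ) ^ #Λ * g ^ #(A \ X) *
        ∏ ℓ ∈ Λ, (1 - ((ξ ℓ).2 : ℝ) / n) ^ (n - (b + 1) * #Λ) := by
    intro i ξ _
    rw [pr_box]
    calc ∏ u, (#(C i ξ u) : ℝ) / Fintype.card (Fin r × Fin n)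
        ≤ ∏ u, ((if u ∈ U then (1 / r : ℝ) else 1) * (if u ∈ X then (1 / n : ℝ) else 1) *
            (if u ∈ A \ X then g else 1) *
            (if u ∈ W then (1 - ((ξ (a u)).2 : ℝ) / n) else 1)) := by
          refine prod_le_prod (fun u _ => by positivity) fun u _ => ?_
          simp only [Fintype.card_prod, Fintype.card_fin, Nat.cast_mul, C, W, mem_sdiff]
          by_cases c1 : u ∈ X
          · have := hXU c1
            simp [c1, this]
            exact le_of_eq (by ring)
          · by_cases c2 : u ∈ A
            · have := hAU c2
              simp only [c1, c2, this]
              simp only [if_true, if_false, not_true_eq_false, not_false_eq_true, and_false,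
                and_self, mul_one]
              rw [div_le_iff₀ (by positivity)]
              refine (hG i).trans (le_of_eq ?_)
              field_simp
            · by_cases c3 : u ∈ U
              · simp only [c1, c2, c3]
                simp only [if_true, if_false, not_false_eq_true,
                  and_self, false_and, mul_one, card_product, card_singleton, one_mul, Fin.card_Ici]
                rw [Nat.cast_sub (ξ (a u)).2.2.le]
                exact le_of_eq (by field_simp)
              · simp [c1, c2, c3]
                rw [div_self (by positivity)]
      _ = (1 / r : ℝ) ^ #U * (1 / n : ℝ) ^ #Λ * g ^ #(A \ X) *
            ∏ u ∈ W, (1 - ((ξ (a u)).2 : ℝ) / n) := by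
          rw [prod_mul_distrib, prod_mul_distrib, prod_mul_distrib]
          simp only [prod_ite_mem, univ_inter, prod_const, hcardX]
      _ = (1 / r : ℝ) ^ #U * (1 / n : ℝ) ^ #Λ * g ^ #(A \ X) *
            ∏ ℓ ∈ Λ, (1 - ((ξ ℓ).2 : ℝ) / n) ^ #{u ∈ W | a u = ℓ} := by
          congr 1
          rw [← prod_fiberwise_of_maps_to (s := W) (t := Λ) (g := a) (fun u hu => ?_)]
          · refine prod_congr rfl fun ℓ _ => ?_
            rw [← prod_const]
            refine prod_congr rfl fun u hu => ?_
            rw [(mem_filter.1 hu).2]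
          · simp only [W, mem_sdiff] at hu
            exact (ha2 u hu.1.1 hu.1.2 hu.2).1
      _ ≤ _ := by
          refine mul_le_mul_of_nonneg_left ?_ (by positivity)
          refine prod_le_prod (fun ℓ _ => pow_nonneg (hfac _).1 _) fun ℓ hℓ => ?_
          exact pow_le_pow_of_le_one (hfac _).1 (hfac _).2 (hfiber ℓ hℓ)
  have hsum : ∑ ξ ∈ Ξ, ∏ ℓ ∈ Λ, (1 - ((ξ ℓ).2 : ℝ) / n) ^ (n - (b + 1) * #Λ) =
      (r * ∑ y : Fin n, (1 - (y : ℝ) / n) ^ (n - (b + 1) * #Λ)) ^ #Λ := by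
    have := prod_univ_sum (fun ℓ : Link V => if ℓ ∈ Λ then (univ : Finset (Fin r × Fin n)) else {s0})
      (fun ℓ s => if ℓ ∈ Λ then (1 - (s.2 : ℝ) / n) ^ (n - (b + 1) * #Λ) else 1)
    simp only [prod_ite_mem, univ_inter] at this
    rw [← this, ← prod_const]
    have h1 : ∀ ℓ : Link V, (∑ s ∈ (if ℓ ∈ Λ then (univ : Finset (Fin r × Fin n)) else {s0}),
        if ℓ ∈ Λ then (1 - (s.2 : ℝ) / n) ^ (n - (b + 1) * #Λ) else 1) =
        if ℓ ∈ Λ then r * ∑ y : Fin n, (1 - (y : ℝ) / n) ^ (n - (b + 1) * #Λ) else 1 := by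
      intro ℓ
      by_cases hℓ : ℓ ∈ Λ
      · simp only [hℓ, if_true]
        rw [Fintype.sum_prod_type]
        simp
      · simp [hℓ]
    rw [prod_congr rfl fun ℓ _ => h1 ℓ, prod_ite_mem, univ_inter]
  calc pr (TreeEvent G A Λ) ≤ ∑ i : Fin r, ∑ ξ ∈ Ξ, pr (fun ω => ∀ u, ω u ∈ C i ξ u) :=
        (pr_mono hcover).trans ((pr_exists_le _ _).trans
          (sum_le_sum fun i _ => pr_exists_le _ _))
    _ ≤ ∑ i : Fin r, ∑ ξ ∈ Ξ, (1 / r : ℝ) ^ #U * (1 / n : ℝ) ^ #Λ * g ^ #(A \ X) *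
        ∏ ℓ ∈ Λ, (1 - ((ξ ℓ).2 : ℝ) / n) ^ (n - (b + 1) * #Λ) :=
        sum_le_sum fun i _ => sum_le_sum fun ξ hξ => hbox i ξ hξ
    _ = _ := by
        simp only [← mul_sum, hsum]
        simp only [sum_const, card_univ, Fintype.card_fin, nsmul_eq_mul]
        rw [show (r : ℝ) / n * ∑ y : Fin n, (1 - (y : ℝ) / n) ^ (n - (b + 1) * #Λ) =
          (1 / n) * (r * ∑ y : Fin n, (1 - (y : ℝ) / n) ^ (n - (b + 1) * #Λ)) by ring, mul_pow]
        ring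

end TreeBounds

/-! ### The recoloring process and its failure trees -/

section Recoloring

variable {V : Type*} {r n : ℕ} [NeZero r]

/-- The vertices in `R` have been recolored from `f v` to `f v + 1` in the order of the times
`t v`; at its time `v` was the non-recolored vertex of least level in the edge `B v`, which was
monochromatic. -/
structure Recoloring (H : Finset (Finset V)) (f : V → Fin r) (σ : V → Fin n) (q : ℕ)
    (R : Finset V) (B : V → Finset V) (t : V → ℕ) : Prop where
  edge_mem : ∀ v ∈ R, B v ∈ H
  mem_edge : ∀ v ∈ R, v ∈ B v
  level_lt : ∀ v ∈ R, (σ v : ℕ) < q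
  time_lt : ∀ v ∈ R, t v < #R
  time_inj : ∀ u ∈ R, ∀ v ∈ R, t u = t v → u = v
  blame : ∀ v ∈ R, ∀ u ∈ B v, (u ∈ R ∧ t u < t v ∧ f u + 1 = f v) ∨
    ((u ∈ R → t v ≤ t u) ∧ f u = f v ∧ σ v ≤ σ u)

/-- The coloring after the recolorings. -/
noncomputable def recolor (f : V → Fin r) (R : Finset V) (u : V) : Fin r :=
  if u ∈ R then f u + 1 else f u

variable {H : Finset (Finset V)} {f : V → Fin r} {σ : V → Fin n} {q : ℕ}

/-- The new time `#R` exceeds all earlier ones, so the earlier blames persist: `v` was not yet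
recolored at those times. -/
lemma Recoloring.extend {R : Finset V} {B : V → Finset V} {t : V → ℕ}
    (h : Recoloring H f σ q R B t) {E : Finset V} (hE : E ∈ H) {i : Fin r}
    (hmono : ∀ u ∈ E, recolor f R u = i) {v : V} (hv : v ∈ E) (hvR : v ∉ R) (hq : (σ v : ℕ) < q)
    (hmin : ∀ u ∈ E, u ∉ R → σ v ≤ σ u) :
    Recoloring H f σ q (insert v R) (Function.update B v E) (Function.update t v #R) := by
  have hne : ∀ u ∈ R, u ≠ v := fun u hu he => hvR (he ▸ hu)
  have hcard : #(insert v R) = #R + 1 := card_insert_of_notMem hvR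
  have hfv : f v = i := by simpa [recolor, hvR] using hmono v hv
  refine ⟨?_, ?_, ?_, ?_, ?_, ?_⟩
  · intro u hu
    rcases mem_insert.1 hu with rfl | hu
    · simpa using hE
    · simpa [hne u hu] using h.edge_mem u hu
  · intro u hu
    rcases mem_insert.1 hu with rfl | hu
    · simpa using hv
    · simpa [hne u hu] using h.mem_edge u hu
  · intro u hu
    rcases mem_insert.1 hu with rfl | hu
    · exact hq
    · exact h.level_lt u hu
  · intro u hu
    rw [hcard]
    rcases mem_insert.1 hu with rfl | hu
    · simp
    · have := h.time_lt u hu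
      simp only [ne_eq, hne u hu, not_false_eq_true, Function.update_of_ne]
      omega
  · intro u hu w hw heq
    rcases mem_insert.1 hu with hu' | hu' <;> rcases mem_insert.1 hw with hw' | hw'
    · rw [hu', hw']
    · have := h.time_lt w hw'
      simp [hu', hne w hw'] at heq
      omega
    · have := h.time_lt u hu'
      simp [hw', hne u hu'] at heq
      omega
    · simp [hne u hu', hne w hw'] at heq
      exact h.time_inj u hu' w hw' heq
  · intro w hw u hu
    rcases mem_insert.1 hw with rfl | hwR
    · simp only [Function.update_self] at hu ⊢
      by_cases huR : u ∈ R
      · left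
        have h1 := hmono u hu
        have h2 := h.time_lt u huR
        simp only [recolor, huR, if_true] at h1
        refine ⟨mem_insert_of_mem huR, ?_, h1.trans hfv.symm⟩
        simpa [hne u huR] using h2
      · right
        have h1 := hmono u hu
        simp only [recolor, huR, if_false] at h1
        refine ⟨fun h2 => ?_, h1.trans hfv.symm, hmin u hu huR⟩
        rcases mem_insert.1 h2 with rfl | h2
        · simp
        · exact absurd h2 huR
    · simp only [ne_eq, hne w hwR, not_false_eq_true, Function.update_of_ne] at hu ⊢
      rcases h.blame w hwR u hu with ⟨h1, h2, h3⟩ | ⟨h1, h2, h3⟩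
      · left
        exact ⟨mem_insert_of_mem h1, by simpa [hne u h1] using h2, h3⟩
      · right
        refine ⟨fun h4 => ?_, h2, h3⟩
        rcases mem_insert.1 h4 with rfl | h4
        · simpa using (h.time_lt w hwR).le
        · simpa [hne u h4] using h1 h4

/-- A recoloring with `R` of maximal size admits no extension, which is the stopping condition of
the process. -/
theorem exists_recoloring [Fintype V] (H : Finset (Finset V)) (f : V → Fin r) (σ : V → Fin n)
    (q : ℕ) : ∃ R B t, Recoloring H f σ q R B t ∧
      ∀ E ∈ H, ∀ i, (∀ u ∈ E, recolor f R u = i) → ∀ u ∈ E, u ∉ R → q ≤ σ u := by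
  have hne : ({R | ∃ B t, Recoloring H f σ q R B t} : Finset (Finset V)).Nonempty :=
    ⟨∅, mem_filter.2 ⟨mem_univ _, fun _ => ∅, fun _ => 0, by constructor <;> simp⟩⟩
  obtain ⟨R, hR, hmax⟩ := exists_max_image _ card hne
  obtain ⟨-, B, t, h⟩ := mem_filter.1 hR
  refine ⟨R, B, t, h, fun E hE i hmono u hu huR => ?_⟩
  by_contra hq
  push Not at hq
  obtain ⟨v, hv, hmin⟩ := exists_min_image (E.filter fun u => u ∉ R) σ
    ⟨u, mem_filter.2 ⟨hu, huR⟩⟩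
  obtain ⟨hvE, hvR⟩ := mem_filter.1 hv
  have hle := hmin u (mem_filter.2 ⟨hu, huR⟩)
  have hext := h.extend hE hmono hvE hvR (lt_of_le_of_lt hle hq)
    fun w hw hwR => hmin w (mem_filter.2 ⟨hw, hwR⟩)
  have := hmax _ (mem_filter.2 ⟨mem_univ _, _, _, hext⟩)
  rw [card_insert_of_notMem hvR] at this
  omega

/-- If `u` and later `v` blamed one edge, the blame of `u` would give `f v = f u` and that of `v`
would give `f u + 1 = f v`. -/
lemma Recoloring.edge_inj (hr : 2 ≤ r) {R : Finset V} {B : V → Finset V} {t : V → ℕ}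
    (h : Recoloring H f σ q R B t) {u v : V} (hu : u ∈ R) (hv : v ∈ R) (he : B u = B v) :
    u = v := by
  have hne : ∀ c : Fin r, c + 1 ≠ c := by
    intro c hc
    have : (1 : Fin r) = 0 := by simpa using hc
    rw [Fin.one_eq_zero_iff] at this
    omega
  have main : ∀ u ∈ R, ∀ v ∈ R, B u = B v → ¬ t u < t v := by
    intro u hu v hv he hlt
    have h1 := h.blame v hv u (he ▸ h.mem_edge u hu)
    have h2 := h.blame u hu v (he.symm ▸ h.mem_edge v hv)
    rcases h1 with ⟨-, -, h1⟩ | ⟨h1, -, -⟩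
    · rcases h2 with ⟨-, h2, -⟩ | ⟨-, h2, -⟩
      · omega
      · rw [h2] at h1
        exact hne _ h1
    · have := h1 hu
      omega
  apply h.time_inj u hu v hv
  have := main u hu v hv he
  have := main v hv u hu he.symm
  omega

/-- The child edge at `x` is `B x`; its parent is `A` or an edge blamed later, so times serve as
ranks. By `hcl`, a vertex of `B x` outside `X` and `A` was not recolored before `x`, and the blame
of `x` then compares its color and level with those of `x`. -/
lemma Recoloring.exists_linkTree (hr : 2 ≤ r) {R : Finset V} {B : V → Finset V} {t : V → ℕ}
    (h : Recoloring H f σ q R B t) {A : Finset V} (hA : A ∈ H) {X : Finset V} (hXR : X ⊆ R)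
    (hXA : ∀ x ∈ X, B x ≠ A) (hpar : ∀ x ∈ X, x ∈ A ∨ ∃ w ∈ X, x ∈ B w ∧ t x < t w)
    (hcl : ∀ x ∈ X, ∀ u ∈ B x, u ∈ R → t u < t x → B u ≠ A → u ∈ X) :
    ∃ Λ, IsLinkTree H A Λ ∧ linkVertices Λ = X ∧ #Λ = #X ∧
      ∀ ℓ ∈ Λ, ∀ u ∈ ℓ.2.1, u ∉ X → u ∉ A → f u = f ℓ.1 ∧ σ ℓ.1 ≤ σ u := by
  have hch : ∀ x, ∃ P : Finset V, x ∈ X → x ∈ P ∧ (P = A ∨ ∃ w ∈ X, B w = P ∧ t x < t w) := by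
    intro x
    by_cases hx : x ∈ X
    · rcases hpar x hx with h1 | ⟨w, hw, h1, h2⟩
      · exact ⟨A, fun _ => ⟨h1, Or.inl rfl⟩⟩
      · exact ⟨B w, fun _ => ⟨h1, Or.inr ⟨w, hw, rfl, h2⟩⟩⟩
    · exact ⟨∅, fun h => absurd h hx⟩
  choose P hP using hch
  have hinj : Set.InjOn (fun x => ((x, B x, P x) : Link V)) X := fun a _ c _ hac =>
    (Prod.ext_iff.1 hac).1
  refine ⟨X.image fun x => (x, B x, P x), ?_, ?_, card_image_of_injOn hinj, ?_⟩
  · refine ⟨?_, ?_, ?_, ?_, hA, ?_, ?_, ?_, ?_⟩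
    · simp only [forall_mem_image]
      intro a _ c _ hac
      rw [show a = c from hac]
    · simp only [forall_mem_image]
      intro a ha c hc hac
      rw [h.edge_inj hr (hXR ha) (hXR hc) hac]
    · simp only [forall_mem_image]
      exact fun x hx => h.mem_edge x (hXR hx)
    · simp only [forall_mem_image]
      exact fun x hx => (hP x hx).1
    · simp only [forall_mem_image]
      exact fun x hx => h.edge_mem x (hXR hx)
    · simpa only [forall_mem_image] using hXA
    · simp only [forall_mem_image, exists_mem_image]
      intro x hx
      rcases (hP x hx).2 with h1 | ⟨w, hw, h1, -⟩
      · exact Or.inl h1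
      · exact Or.inr ⟨w, hw, h1⟩
    -- The default `#R` exceeds all times and is the rank of `A`, which no vertex of `X` blames.
    · let τ : Finset V → ℕ := fun E =>
        if hE : ∃ x ∈ X, B x = E then t hE.choose else #R
      have hτ : ∀ x ∈ X, τ (B x) = t x := by
        intro x hx
        have hE : ∃ y ∈ X, B y = B x := ⟨x, hx, rfl⟩
        simp only [τ, hE, dif_pos]
        rw [h.edge_inj hr (hXR hE.choose_spec.1) (hXR hx) hE.choose_spec.2]
      refine ⟨τ, ?_⟩
      simp only [forall_mem_image]
      intro x hx
      rw [hτ x hx]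
      rcases (hP x hx).2 with h1 | ⟨w, hw, h1, h2⟩
      · rw [h1]
        have : ¬ ∃ x ∈ X, B x = A := fun ⟨y, hy, hyA⟩ => hXA y hy hyA
        simp only [τ, this, dif_neg, not_false_eq_true]
        exact h.time_lt x (hXR hx)
      · rw [← h1, hτ w hw]
        exact h2
  · rw [linkVertices, image_image]
    exact image_id
  · simp only [forall_mem_image]
    intro x hx u hu huX huA
    rcases h.blame x (hXR hx) u hu with ⟨h1, h2, -⟩ | ⟨-, h2⟩
    · exfalso
      refine huX (hcl x hx u hu h1 h2 fun he => huA ?_)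
      rw [← he]
      exact h.mem_edge u h1
    · exact h2

/-- `b` was recolored before `a` in the edge blamed by `a`, and `b` does not blame `A`. -/
def Precedes (R : Finset V) (B : V → Finset V) (t : V → ℕ) (A : Finset V) (a b : V) : Prop :=
  b ∈ R ∧ b ∈ B a ∧ t b < t a ∧ B b ≠ A

/-- The vertices on which the recoloring of `x` depends. -/
noncomputable def past (R : Finset V) (B : V → Finset V) (t : V → ℕ) (A : Finset V) (x : V) :
    Finset V :=
  R.filter fun u => Relation.ReflTransGen (Precedes R B t A) x u

lemma time_le_of_reflTransGen {R : Finset V} {B : V → Finset V} {t : V → ℕ} {A : Finset V}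
    {x u : V} (h : Relation.ReflTransGen (Precedes R B t A) x u) : t u ≤ t x := by
  induction h with
  | refl => rfl
  | tail _ h1 ih => exact h1.2.2.1.le.trans ih

/-- Times strictly decrease along `Precedes` and only `x` blames `B x`, so forbidding `B x` excludes
nothing. -/
lemma Recoloring.past_subset (hr : 2 ≤ r) {R : Finset V} {B : V → Finset V} {t : V → ℕ}
    (h : Recoloring H f σ q R B t) (A : Finset V) {x : V} (hx : x ∈ R) :
    past R B t A x ⊆ past R B t (B x) x := by
  intro u hu
  obtain ⟨huR, hxu⟩ := mem_filter.1 hu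
  refine mem_filter.2 ⟨huR, ?_⟩
  clear huR hu
  induction hxu with
  | refl => exact Relation.ReflTransGen.refl
  | tail h1 h2 ih =>
    refine ih.tail ⟨h2.1, h2.2.1, h2.2.2.1, fun he => ?_⟩
    have := time_le_of_reflTransGen h1
    have := h2.2.2.1
    rw [h.edge_inj hr h2.1 hx he] at this
    omega

/-- Adding the sets one at a time, the union grows by at most `L` per step and cannot jump over the
interval from `L` to `2 * L`. -/
lemma exists_subfamily_card_biUnion {ι κ : Type*} (Y : Finset ι) (C : ι → Finset κ) {L : ℕ}
    (hC : ∀ y ∈ Y, #(C y) ≤ L) (hL : L ≤ #(Y.biUnion C)) :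
    ∃ Z ⊆ Y, L ≤ #(Z.biUnion C) ∧ #(Z.biUnion C) ≤ 2 * L := by
  induction Y using Finset.induction_on with
  | empty => exact ⟨∅, Subset.rfl, hL, by simp⟩
  | insert a Y ha ih =>
    by_cases h1 : L ≤ #(Y.biUnion C)
    · obtain ⟨Z, hZ, h2⟩ := ih (fun y hy => hC y (mem_insert_of_mem hy)) h1
      exact ⟨Z, hZ.trans (subset_insert _ _), h2⟩
    · refine ⟨insert a Y, Subset.rfl, hL, ?_⟩
      rw [biUnion_insert]
      have h2 := card_union_le (C a) (Y.biUnion C)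
      have h3 := hC a (mem_insert_self _ _)
      omega

/-- The levels and colors of the root of a small failing tree. -/
noncomputable def smallRoot (q : ℕ) (i : Fin r) : Finset (Fin r × Fin n) :=
  {s | s.1 = i ∧ q ≤ s.2}

/-- The levels and colors of the root of a large tree. -/
noncomputable def largeRoot (q : ℕ) (i : Fin r) : Finset (Fin r × Fin n) :=
  {s | s.1 = i ∨ (s.1 + 1 = i ∧ (s.2 : ℕ) < q)}

lemma Recoloring.exists_linkTree_past (hr : 2 ≤ r) {R : Finset V} {B : V → Finset V} {t : V → ℕ}
    (h : Recoloring H f σ q R B t) {A : Finset V} (hA : A ∈ H) {Y : Finset V}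
    (hY : ∀ y ∈ Y, y ∈ R ∧ y ∈ A ∧ B y ≠ A) :
    ∃ Λ, IsLinkTree H A Λ ∧ linkVertices Λ = Y.biUnion (past R B t A) ∧
      #Λ = #(Y.biUnion (past R B t A)) ∧
      ∀ ℓ ∈ Λ, ∀ u ∈ ℓ.2.1, u ∉ linkVertices Λ → u ∉ A → f u = f ℓ.1 ∧ σ ℓ.1 ≤ σ u := by
  have hmem : ∀ x, x ∈ Y.biUnion (past R B t A) ↔
      ∃ y ∈ Y, x ∈ R ∧ Relation.ReflTransGen (Precedes R B t A) y x := by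
    intro x; simp [past]
  obtain ⟨Λ, h1, h2, h3, h4⟩ := h.exists_linkTree hr hA (X := Y.biUnion (past R B t A))
    (fun x hx => by
      obtain ⟨y, hy, hxR, -⟩ := (hmem x).1 hx
      exact hxR)
    (fun x hx => by
      obtain ⟨y, hy, hxR, hyx⟩ := (hmem x).1 hx
      rcases Relation.ReflTransGen.cases_tail hyx with rfl | ⟨w, -, hw⟩
      · exact (hY _ hy).2.2
      · exact hw.2.2.2)
    (fun x hx => by
      obtain ⟨y, hy, hxR, hyx⟩ := (hmem x).1 hx
      rcases Relation.ReflTransGen.cases_tail hyx with rfl | ⟨w, hyw, hw⟩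
      · exact Or.inl (hY _ hy).2.1
      · refine Or.inr ⟨w, (hmem w).2 ⟨y, hy, ?_, hyw⟩, hw.2.1, hw.2.2.1⟩
        rcases Relation.ReflTransGen.cases_tail hyw with rfl | ⟨z, -, hz⟩
        · exact (hY _ hy).1
        · exact hz.1)
    (fun x hx u hu huR ht hne => by
      obtain ⟨y, hy, hxR, hyx⟩ := (hmem x).1 hx
      exact (hmem u).2 ⟨y, hy, huR, hyx.tail ⟨huR, hu, ht, hne⟩⟩)
  exact ⟨Λ, h1, h2, h3, by rw [h2]; exact h4⟩

/-- If some recolored vertex has a past of more than `L` vertices, let `v` be the earliest one. The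
vertices preceding it have small pasts, and a union of these of size between `L` and `2 * L` gives a
large tree with root `B v`. Otherwise all pasts are small: if those entering `A` have a union of
size at least `L`, the same cut gives a large tree with root `A`; if not, all of them together form
a small tree. -/
theorem Recoloring.exists_treeEvent (hr : 2 ≤ r) {R : Finset V} {B : V → Finset V} {t : V → ℕ}
    (h : Recoloring H f σ q R B t) (hn : ∀ E ∈ H, #E = n) {L : ℕ} (hL : L < n)
    {A : Finset V} (hA : A ∈ H) {i : Fin r} (hmono : ∀ u ∈ A, recolor f R u = i)
    (hterm : ∀ u ∈ A, u ∉ R → q ≤ σ u) :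
    ∃ A Λ, IsLinkTree H A Λ ∧
      ((#Λ < L ∧ TreeEvent (smallRoot q) A Λ fun u => (f u, σ u)) ∨
       (L ≤ #Λ ∧ #Λ ≤ 2 * L ∧ TreeEvent (largeRoot q) A Λ fun u => (f u, σ u))) := by
  have hsucc : ∀ c : Fin r, c + 1 ≠ c := by
    intro c hc
    have : (1 : Fin r) = 0 := by simpa using hc
    rw [Fin.one_eq_zero_iff] at this
    omega
  by_cases hbig : ∃ v ∈ R, L < #(past R B t (B v) v)
  · obtain ⟨v, hv, hmin⟩ := exists_min_image (R.filter fun v => L < #(past R B t (B v) v)) t (by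
      obtain ⟨v, hv, hv'⟩ := hbig
      exact ⟨v, mem_filter.2 ⟨hv, hv'⟩⟩)
    obtain ⟨hvR, hvL⟩ := mem_filter.1 hv
    let Y := R.filter fun u => Precedes R B t (B v) v u
    have hY : ∀ y ∈ Y, y ∈ R ∧ y ∈ B v ∧ B y ≠ B v := fun y hy =>
      let h1 := (mem_filter.1 hy).2
      ⟨h1.1, h1.2.1, h1.2.2.2⟩
    have hpast : ∀ y ∈ Y, #(past R B t (B v) y) ≤ L := by
      intro y hy
      by_contra hcon
      push Not at hcon
      have h1 := (mem_filter.1 hy).2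
      have := hmin y (mem_filter.2 ⟨h1.1, hcon.trans_le (card_le_card (h.past_subset hr _ h1.1))⟩)
      have := h1.2.2.1
      omega
    have hsub : past R B t (B v) v ⊆ insert v (Y.biUnion (past R B t (B v))) := by
      intro u hu
      obtain ⟨huR, hu⟩ := mem_filter.1 hu
      rcases Relation.ReflTransGen.cases_head hu with rfl | ⟨w, hw, hwu⟩
      · exact mem_insert_self _ _
      · exact mem_insert_of_mem (mem_biUnion.2 ⟨w, mem_filter.2 ⟨hw.1, hw⟩,
          mem_filter.2 ⟨huR, hwu⟩⟩)
    have hcard := (card_le_card hsub).trans (card_insert_le _ _)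
    obtain ⟨Z, hZ, hZ1, hZ2⟩ := exists_subfamily_card_biUnion Y _ hpast (by omega)
    obtain ⟨Λ, h1, h2, h3, h4⟩ := h.exists_linkTree_past hr (h.edge_mem v hvR)
      (fun y hy => hY y (hZ hy))
    refine ⟨B v, Λ, h1, Or.inr ⟨by omega, by omega, ⟨f v, fun u hu _ => ?_⟩, h4⟩⟩
    simp only [largeRoot, mem_filter, mem_univ, true_and]
    rcases h.blame v hvR u hu with ⟨h5, -, h6⟩ | ⟨-, h6, -⟩
    · exact Or.inr ⟨h6, h.level_lt u h5⟩
    · exact Or.inl h6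
  · push Not at hbig
    let Y := R.filter fun u => u ∈ A ∧ B u ≠ A
    have hY : ∀ y ∈ Y, y ∈ R ∧ y ∈ A ∧ B y ≠ A := fun y hy => mem_filter.1 hy
    have hself : ∀ y ∈ Y, y ∈ Y.biUnion (past R B t A) := fun y hy =>
      mem_biUnion.2 ⟨y, hy, mem_filter.2 ⟨(hY y hy).1, Relation.ReflTransGen.refl⟩⟩
    by_cases hYL : L ≤ #(Y.biUnion (past R B t A))
    · obtain ⟨Z, hZ, hZ1, hZ2⟩ := exists_subfamily_card_biUnion Y _ (fun y hy =>
        (card_le_card (h.past_subset hr A (hY y hy).1)).trans (hbig y (hY y hy).1)) hYL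
      obtain ⟨Λ, h1, h2, h3, h4⟩ := h.exists_linkTree_past hr hA (fun y hy => hY y (hZ hy))
      refine ⟨A, Λ, h1, Or.inr ⟨by omega, by omega, ⟨i, fun u hu _ => ?_⟩, h4⟩⟩
      simp only [largeRoot, mem_filter, mem_univ, true_and]
      have h5 := hmono u hu
      by_cases huR : u ∈ R
      · rw [recolor, if_pos huR] at h5
        exact Or.inr ⟨h5, h.level_lt u huR⟩
      · rw [recolor, if_neg huR] at h5
        exact Or.inl h5
    · obtain ⟨Λ, h1, h2, h3, h4⟩ := h.exists_linkTree_past hr hA hY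
      refine ⟨A, Λ, h1, Or.inl ⟨by omega, ⟨i, fun u hu huX => ?_⟩, h4⟩⟩
      rw [h2] at huX
      have huR : u ∉ R := by
        intro huR
        have hBu : B u = A := by
          by_contra hne
          exact huX (hself u (mem_filter.2 ⟨huR, hu, hne⟩))
        -- If `u` blames `A`, all other vertices of `A` were recolored as well, since one that was
        -- not would end one color behind `u`. None of them blames `A`, so all are link vertices,
        -- too many for a small tree.
        have hsub : A.erase u ⊆ Y.biUnion (past R B t A) := by
          intro w hw
          obtain ⟨hwu, hwA⟩ := mem_erase.1 hw
          have hwR : w ∈ R := by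
            by_contra hwR
            rcases h.blame u huR w (hBu.symm ▸ hwA) with ⟨h5, -⟩ | ⟨-, h5, -⟩
            · exact hwR h5
            · have h6 := hmono w hwA
              have h7 := hmono u hu
              rw [recolor, if_neg hwR] at h6
              rw [recolor, if_pos huR, ← h6, h5] at h7
              exact hsucc _ h7
          refine hself w (mem_filter.2 ⟨hwR, hwA, fun he => hwu ?_⟩)
          exact h.edge_inj hr hwR huR (he.trans hBu.symm)
        have := card_le_card hsub
        rw [card_erase_of_mem hu, hn A hA] at this
        omega
      have h5 := hmono u hu
      rw [recolor, if_neg huR] at h5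
      simp only [smallRoot, mem_filter, mem_univ, true_and]
      exact ⟨h5, hterm u hu huR⟩

end Recoloring

/-! ### The local lemma sum for a fixed number of links -/

section Core

variable {V : Type*} {H : Finset (Finset V)} {n b : ℕ}

/-- Each such edge selects a `(b + 1)`-subset of `U`, and no two edges contain the same one. -/
lemma card_large_intersection_le (hb : ∀ E ∈ H, ∀ F ∈ H, E ≠ F → #(E ∩ F) ≤ b) (U : Finset V) :
    #{E ∈ H | b < #(E ∩ U)} ≤ #U ^ (b + 1) := by
  have hch : ∀ E : Finset V, ∃ T : Finset V, b < #(E ∩ U) → T ⊆ E ∩ U ∧ #T = b + 1 := by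
    intro E
    by_cases hE : b < #(E ∩ U)
    · obtain ⟨T, hT⟩ := exists_subset_card_eq (s := E ∩ U) (n := b + 1) hE
      exact ⟨T, fun _ => hT⟩
    · exact ⟨∅, fun h => absurd h hE⟩
  choose T hT using hch
  calc #{E ∈ H | b < #(E ∩ U)} ≤ #(U.powersetCard (b + 1)) := by
        refine card_le_card_of_injOn T ?_ ?_
        · intro E hE
          have := hT E (mem_filter.1 hE).2
          exact mem_powersetCard.2 ⟨this.1.trans inter_subset_right, this.2⟩
        · intro E hE F hF heq
          obtain ⟨hE1, hE2⟩ := mem_filter.1 hE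
          obtain ⟨hF1, hF2⟩ := mem_filter.1 hF
          by_contra hne
          have h1 := hb E hE1 F hF1 hne
          have h2 : T E ⊆ E ∩ F := subset_inter ((hT E hE2).1.trans inter_subset_left)
            (heq ▸ (hT F hF2).1.trans inter_subset_left)
          have h3 := card_le_card h2
          rw [(hT E hE2).2] at h3
          omega
    _ = (#U).choose (b + 1) := card_powersetCard _ _
    _ ≤ _ := Nat.choose_le_pow _ _

/-- An edge meeting `cover F` in at most `b` vertices has at least `n - b` new ones, and at most `D`
edges pass through `v`. The exceptional edges are few by `card_large_intersection_le`, and still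
have at least `n - b * s` new vertices because they meet each edge of `F` in at most `b`. -/
lemma sum_new_edges_le (hn : ∀ E ∈ H, #E = n)
    (hb : ∀ E ∈ H, ∀ F ∈ H, E ≠ F → #(E ∩ F) ≤ b) {D ρ : ℝ} (h0 : 0 ≤ ρ) (h1 : ρ ≤ 1)
    (hD : ∀ v, (#{E ∈ H | v ∈ E} : ℝ) ≤ D) {s : ℕ} {F : Finset (Finset V)} (hF : F ⊆ H)
    (hs : #F ≤ s) (v : V) :
    ∑ E ∈ H with v ∈ E ∧ E ∉ F, ρ ^ #(E \ cover F) ≤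
      D * ρ ^ (n - b) + (s * n : ℝ) ^ (b + 1) * ρ ^ (n - b * s) := by
  have hU : #(cover F) ≤ s * n :=
    (card_biUnion_le_card_mul F id n fun E hE => (hn E (hF hE)).le).trans
      (Nat.mul_le_mul_right _ hs)
  have hterm : ∀ E ∈ H.filter fun E => v ∈ E ∧ E ∉ F, ρ ^ #(E \ cover F) ≤
      ρ ^ (n - b) + if b < #(E ∩ cover F) then ρ ^ (n - b * s) else 0 := by
    intro E hE
    obtain ⟨hE, -, hEF⟩ := mem_filter.1 hE
    have hc := card_sdiff_add_card_inter E (cover F)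
    rw [hn E hE] at hc
    split_ifs with hlt
    · have h2 : #(E ∩ cover F) ≤ b * s := by
        have : E ∩ cover F ⊆ F.biUnion fun X => E ∩ X := by
          intro u hu
          obtain ⟨h3, h4⟩ := mem_inter.1 hu
          obtain ⟨X, hX, h5⟩ := mem_biUnion.1 h4
          exact mem_biUnion.2 ⟨X, hX, mem_inter.2 ⟨h3, h5⟩⟩
        refine (card_le_card this).trans ((card_biUnion_le_card_mul F _ b fun X hX => ?_).trans ?_)
        · exact hb E hE X (hF hX) fun he => hEF (he ▸ hX)
        · rw [mul_comm]; exact Nat.mul_le_mul_left _ hs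
      have : ρ ^ #(E \ cover F) ≤ ρ ^ (n - b * s) := pow_le_pow_of_le_one h0 h1 (by omega)
      have := pow_nonneg h0 (n - b)
      linarith
    · rw [add_zero]
      exact pow_le_pow_of_le_one h0 h1 (by omega)
  refine (sum_le_sum hterm).trans ?_
  rw [sum_add_distrib]
  refine add_le_add ?_ ?_
  · rw [sum_const, nsmul_eq_mul]
    refine mul_le_mul_of_nonneg_right (le_trans ?_ (hD v)) (pow_nonneg h0 _)
    have h2 : #{E ∈ H | v ∈ E ∧ E ∉ F} ≤ #{E ∈ H | v ∈ E} := card_le_card fun E hE =>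
      mem_filter.2 ⟨(mem_filter.1 hE).1, (mem_filter.1 hE).2.1⟩
    exact_mod_cast h2
  · rw [← sum_filter, sum_const, nsmul_eq_mul]
    refine mul_le_mul_of_nonneg_right ?_ (pow_nonneg h0 _)
    have h2 : #{E ∈ H.filter (fun E => v ∈ E ∧ E ∉ F) | b < #(E ∩ cover F)} ≤
        (s * n) ^ (b + 1) := by
      refine (card_le_card ?_).trans ((card_large_intersection_le hb (cover F)).trans
        (Nat.pow_le_pow_left hU _))
      exact filter_subset_filter _ (filter_subset _ _)
    exact_mod_cast h2

lemma sum_one_sub_pow_le (hn0 : 0 < n) {h : ℕ} (hh : n ≤ 2 * h) :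
    ∑ y : Fin n, (1 - (y : ℝ) / n) ^ h ≤ 3 := by
  have hn' : (0 : ℝ) < n := by exact_mod_cast hn0
  have hhalf : Real.exp (-(1 / 2)) ≤ 2 / 3 := by
    rw [Real.exp_neg, inv_le_comm₀ (Real.exp_pos _) (by norm_num)]
    have := Real.add_one_le_exp (1 / 2 : ℝ)
    norm_num at this ⊢
    linarith
  calc ∑ y : Fin n, (1 - (y : ℝ) / n) ^ h ≤ ∑ y : Fin n, (2 / 3 : ℝ) ^ (y : ℕ) := by
        refine sum_le_sum fun y _ => ?_
        have h1 : 0 ≤ 1 - (y : ℝ) / n := by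
          rw [sub_nonneg, div_le_one hn']; exact_mod_cast y.2.le
        calc (1 - (y : ℝ) / n) ^ h ≤ (Real.exp (-((y : ℝ) / n))) ^ h :=
              pow_le_pow_left₀ h1 (Real.one_sub_le_exp_neg _) _
          _ = Real.exp (-((y : ℝ) * (h / n))) := by
              rw [← Real.exp_nat_mul]; congr 1; ring
          _ ≤ Real.exp (-((y : ℝ) * (1 / 2))) := by
              have h2 : (n : ℝ) ≤ 2 * h := by exact_mod_cast hh
              have h3 : (1 / 2 : ℝ) ≤ h / n := by
                rw [div_le_div_iff₀ (by norm_num) hn']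
                linarith
              exact Real.exp_le_exp.2 (neg_le_neg (mul_le_mul_of_nonneg_left h3 (by positivity)))
          _ = Real.exp (-(1 / 2)) ^ (y : ℕ) := by
              rw [← Real.exp_nat_mul]; congr 1; ring
          _ ≤ _ := pow_le_pow_left₀ (Real.exp_pos _).le hhalf _
    _ = ∑ y ∈ range n, (2 / 3 : ℝ) ^ y := Fin.sum_univ_eq_sum_range (fun y => (2 / 3 : ℝ) ^ y) n
    _ ≤ 3 := by
        rw [geom_sum_eq (by norm_num)]
        have : (0 : ℝ) < (2 / 3) ^ n := by positivity
        rw [div_le_iff_of_neg (by norm_num)]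
        linarith

lemma choose_succ_mul_le (m n : ℕ) :
    (((m + 1) * n).choose m : ℝ) ≤ (n : ℝ) ^ m * 3 ^ (m + 1) := by
  have h1 := Nat.choose_le_pow_div (α := ℝ) m ((m + 1) * n)
  have h2 := Real.pow_div_factorial_le_exp (m + 1 : ℝ) (by positivity) m
  have h3 : Real.exp (m + 1 : ℝ) ≤ 3 ^ (m + 1) := by
    have : Real.exp (m + 1 : ℝ) = Real.exp 1 ^ (m + 1) := by
      rw [← Real.exp_nat_mul]; push_cast; ring_nf
    rw [this]
    exact pow_le_pow_left₀ (Real.exp_pos _).le (by have := Real.exp_one_lt_d9; linarith) _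
  push_cast at h1
  calc _ ≤ _ := h1
    _ = (n : ℝ) ^ m * (((m : ℝ) + 1) ^ m / m.factorial) := by rw [mul_pow]; ring
    _ ≤ _ := by gcongr; exact h2.trans h3

lemma inv_one_sub_inv_pow_le (hn : 2 ≤ n) : ((1 - 1 / (n : ℝ))⁻¹) ^ n ≤ 8 := by
  have hn' : (2 : ℝ) ≤ n := by exact_mod_cast hn
  have h1 : (1 - 1 / (n : ℝ))⁻¹ ≤ Real.exp (2 / n) := by
    rw [inv_le_comm₀ (by rw [sub_pos, div_lt_one] <;> linarith) (Real.exp_pos _), ← Real.exp_neg]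
    have h2 := Real.add_one_le_exp (2 / n : ℝ)
    have h3 : (0 : ℝ) < 2 / n + 1 := by positivity
    rw [Real.exp_neg]
    refine (inv_anti₀ h3 h2).trans ?_
    rw [inv_le_iff_one_le_mul₀ h3]
    have h4 : 0 ≤ 1 / (n : ℝ) := by positivity
    have h5 : 1 / (n : ℝ) ≤ 1 / 2 := one_div_le_one_div_of_le (by norm_num) hn'
    rw [show (2 : ℝ) / n = 2 * (1 / n) by ring]
    nlinarith
  calc ((1 - 1 / (n : ℝ))⁻¹) ^ n ≤ (Real.exp (2 / n)) ^ n := by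
        refine pow_le_pow_left₀ (inv_nonneg.2 ?_) h1 _
        rw [sub_nonneg, div_le_one] <;> linarith
    _ = Real.exp 1 ^ 2 := by
        rw [← Real.exp_nat_mul, ← Real.exp_nat_mul]
        congr 1
        field_simp
        norm_num
    _ ≤ 2.7182818286 ^ 2 := pow_le_pow_left₀ (Real.exp_pos _).le Real.exp_one_lt_d9.le _
    _ ≤ 8 := by norm_num

variable [Fintype V] {r : ℕ}

/-- The contribution of the link trees with `m` links to the local lemma sum at a vertex. -/
theorem sum_pr_treeEvent_le (hr : 0 < r) (hn2 : 2 ≤ n) (hn : ∀ E ∈ H, #E = n)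
    (hb : ∀ E ∈ H, ∀ F ∈ H, E ≠ F → #(E ∩ F) ≤ b) {s m : ℕ}
    (hκ : ∀ F ⊆ H, #F ≤ s → ∀ v,
      ∑ E ∈ H with v ∈ E ∧ E ∉ F, (1 / r : ℝ) ^ #(E \ cover F) ≤ 1 / (576 * r))
    (hms : m + 1 ≤ s) (hm : 2 * ((b + 1) * m) ≤ n) (v : V)
    (𝒯 : Finset (Finset V × Finset (Link V)))
    (h𝒯 : ∀ T ∈ 𝒯, IsLinkTree H T.1 T.2 ∧ #T.2 = m ∧ v ∈ cover (treeEdges T.1 T.2))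
    (G : Fin r → Finset (Fin r × Fin n)) {g γ : ℝ} (hG : ∀ i, (#(G i) : ℝ) ≤ n * g)
    (hγ0 : 0 ≤ γ) (hγ : ∀ k, n ≤ 2 * k → k ≤ n → g ^ k ≤ γ) :
    ∑ T ∈ 𝒯, pr (TreeEvent G T.1 T.2) * ((1 - 1 / (n : ℝ))⁻¹) ^ #(cover (treeEdges T.1 T.2)) ≤
      1 / 24 * γ * (1 / 4) ^ m := by
  have hr' : (0 : ℝ) < r := by exact_mod_cast hr
  have hn' : (2 : ℝ) ≤ n := by exact_mod_cast hn2
  have hρ1 : (1 / r : ℝ) ≤ 1 := by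
    rw [div_le_one hr']; exact_mod_cast hr
  have hz : 1 ≤ (1 - 1 / (n : ℝ))⁻¹ := by
    have h1 : (1 : ℝ) / n ≤ 1 / 2 := one_div_le_one_div_of_le (by norm_num) hn'
    have h2 : (0 : ℝ) ≤ 1 / n := by positivity
    rw [one_le_inv₀ (by linarith)]
    linarith
  have hterm : ∀ T ∈ 𝒯, pr (TreeEvent G T.1 T.2) *
      ((1 - 1 / (n : ℝ))⁻¹) ^ #(cover (treeEdges T.1 T.2)) ≤
      (r * ((r : ℝ) / n * 3) ^ m * γ * 8 ^ (m + 1)) *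
        (1 / r : ℝ) ^ #(cover (treeEdges T.1 T.2)) := by
    intro T hT
    obtain ⟨ht, hTm, -⟩ := h𝒯 T hT
    have h1 := pr_treeEvent_le hr (by omega) ht hn hb G hG
    rw [hTm] at h1
    have h2 : ∑ y : Fin n, (1 - (y : ℝ) / n) ^ (n - (b + 1) * m) ≤ 3 :=
      sum_one_sub_pow_le (by omega) (by omega)
    have h20 : 0 ≤ ∑ y : Fin n, (1 - (y : ℝ) / n) ^ (n - (b + 1) * m) := by
      refine sum_nonneg fun y _ => pow_nonneg ?_ _
      rw [sub_nonneg, div_le_one (by linarith)]; exact_mod_cast y.2.le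
    have h3 : g ^ #(T.1 \ linkVertices T.2) ≤ γ := by
      have h4 : #T.1 = n := hn _ ht.root_mem
      have h5 : #(linkVertices T.2) ≤ m := hTm ▸ card_image_le
      have h6 := le_card_sdiff (linkVertices T.2) T.1
      have h7 : #(T.1 \ linkVertices T.2) ≤ #T.1 := card_le_card sdiff_subset
      have h8 : m ≤ (b + 1) * m := Nat.le_mul_of_pos_left _ (by omega)
      exact hγ _ (by omega) (by omega)
    have h4 : #(cover (treeEdges T.1 T.2)) ≤ (m + 1) * n := by
      refine (card_biUnion_le_card_mul _ _ n fun E hE =>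
        (hn E (ht.treeEdges_subset hE)).le).trans (Nat.mul_le_mul_right _ ?_)
      refine (card_insert_le _ _).trans (Nat.add_le_add_right ?_ 1)
      exact hTm ▸ card_image_le
    have h5 : ((1 - 1 / (n : ℝ))⁻¹) ^ #(cover (treeEdges T.1 T.2)) ≤ 8 ^ (m + 1) := by
      refine (pow_le_pow_right₀ hz h4).trans ?_
      rw [mul_comm, pow_mul]
      exact pow_le_pow_left₀ (by positivity) (inv_one_sub_inv_pow_le hn2) _
    have hg : 0 ≤ g ^ #(T.1 \ linkVertices T.2) := by
      have := (Nat.cast_nonneg _).trans (hG ⟨0, hr⟩)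
      exact pow_nonneg (nonneg_of_mul_nonneg_right this (by linarith)) _
    calc _ ≤ (r * (1 / r : ℝ) ^ #(cover (treeEdges T.1 T.2)) * ((r : ℝ) / n * 3) ^ m * γ) *
            8 ^ (m + 1) := by
          refine mul_le_mul (h1.trans ?_) h5 (by positivity) (by positivity)
          gcongr
      _ = _ := by ring
  have hsum := sum_trees_le hn (by positivity) hρ1 hκ hms v 𝒯 h𝒯
  calc _ ≤ _ := sum_le_sum hterm
    _ = (r * ((r : ℝ) / n * 3) ^ m * γ * 8 ^ (m + 1)) *
          ∑ T ∈ 𝒯, (1 / r : ℝ) ^ #(cover (treeEdges T.1 T.2)) := by rw [mul_sum]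
    _ ≤ (r * ((r : ℝ) / n * 3) ^ m * γ * 8 ^ (m + 1)) *
          (1 / (576 * r) * (2 * (1 / (576 * r))) ^ m * ((n : ℝ) ^ m * 3 ^ (m + 1))) := by
        refine mul_le_mul_of_nonneg_left (hsum.trans ?_) (by positivity)
        gcongr
        exact choose_succ_mul_le m n
    -- The ratio is `3 * 8 * 2 * 3 / 576 = 1 / 4`: a 3 from the level sum, 8 from `(1 - 1 / n)⁻¹ ^
    -- n`, 2 from the orientation of links, and a 3 from the binomial coefficient. The prefactor is
    -- `8 * 3 / 576`.
    _ = 1 / 24 * γ * (((r : ℝ) / n * 3) * 8 * (2 * (1 / (576 * r))) * n * 3) ^ m := by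
        simp only [mul_pow, pow_succ]
        field_simp
        ring
    _ = _ := by
        congr 2
        field_simp
        norm_num

end Core

/-! ### Coloring hypergraphs of bounded degree -/

section CoreTheorem

lemma card_smallRoot_le {r n q : ℕ} (hq : q < n) (i : Fin r) :
    (#(smallRoot (n := n) q i) : ℝ) ≤ n * (1 - (q : ℝ) / n) := by
  have hsub : smallRoot (n := n) q i ⊆ {i} ×ˢ Ici (⟨q, hq⟩ : Fin n) := by
    intro s hs
    simp only [smallRoot, mem_filter, mem_univ, true_and] at hs
    exact mem_product.2 ⟨mem_singleton.2 hs.1, mem_Ici.2 hs.2⟩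
  have hc := card_le_card hsub
  rw [card_product, card_singleton, one_mul, Fin.card_Ici] at hc
  have hn' : (0 : ℝ) < n := by exact_mod_cast (by omega : 0 < n)
  calc (#(smallRoot (n := n) q i) : ℝ) ≤ ((n - q : ℕ) : ℝ) := by exact_mod_cast hc
    _ = n * (1 - (q : ℝ) / n) := by
        rw [Nat.cast_sub hq.le]
        field_simp

lemma card_largeRoot_le {r n q : ℕ} [NeZero r] (hn : 0 < n) (i : Fin r) :
    (#(largeRoot (n := n) q i) : ℝ) ≤ n * (1 + (q : ℝ) / n) := by
  have hsub : largeRoot (n := n) q i ⊆ {i} ×ˢ univ ∪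
      {i - 1} ×ˢ (univ : Finset (Fin n)).filter fun y : Fin n => (y : ℕ) < q := by
    intro s hs
    simp only [largeRoot, mem_filter, mem_univ, true_and] at hs
    rcases hs with hs | ⟨h1, h2⟩
    · exact mem_union_left _ (mem_product.2 ⟨mem_singleton.2 hs, mem_univ _⟩)
    · exact mem_union_right _ (mem_product.2 ⟨mem_singleton.2 (eq_sub_of_add_eq h1),
        mem_filter.2 ⟨mem_univ _, h2⟩⟩)
  have hq : #((univ : Finset (Fin n)).filter fun y : Fin n => (y : ℕ) < q) ≤ q := by
    have := card_le_card_of_injOn (s := (univ : Finset (Fin n)).filter fun y : Fin n => (y : ℕ) < q)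
      (t := range q) (fun y => (y : ℕ))
      (fun y hy => mem_coe.2 (mem_range.2 (mem_filter.1 hy).2))
      (fun y _ z _ h => Fin.ext h)
    rwa [card_range] at this
  have hc := (card_le_card hsub).trans (card_union_le _ _)
  rw [card_product, card_product, card_singleton, card_singleton, one_mul, one_mul, card_univ,
    Fintype.card_fin] at hc
  have hn' : (0 : ℝ) < n := by exact_mod_cast hn
  calc (#(largeRoot (n := n) q i) : ℝ) ≤ ((n + q : ℕ) : ℝ) := by exact_mod_cast (by omega)
    _ = n * (1 + (q : ℝ) / n) := by
        push_cast
        field_simp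

lemma half_pow_clog_le {n : ℕ} (hn : 0 < n) : (1 / 2 : ℝ) ^ Nat.clog 2 n ≤ 1 / n := by
  have hn' : (0 : ℝ) < n := by exact_mod_cast hn
  rw [div_pow, one_pow]
  apply one_div_le_one_div_of_le hn'
  exact_mod_cast Nat.le_pow_clog (by norm_num) n

lemma one_sub_div_pow_le {n t k : ℕ} (hn : 0 < n) (ht : 2 * t ≤ n) (hk : n ≤ 2 * k) :
    (1 - ((2 * t : ℕ) : ℝ) / n) ^ k ≤ (1 / 2) ^ t := by
  have hn' : (0 : ℝ) < n := by exact_mod_cast hn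
  have h1 : 0 ≤ 1 - ((2 * t : ℕ) : ℝ) / n := by
    rw [sub_nonneg, div_le_one hn']; exact_mod_cast ht
  have h2 : (n : ℝ) ≤ 2 * k := by exact_mod_cast hk
  have h3 : (1 : ℝ) ≤ 2 * k / n := by rwa [le_div_iff₀ hn', one_mul]
  calc (1 - ((2 * t : ℕ) : ℝ) / n) ^ k ≤ Real.exp (-(((2 * t : ℕ) : ℝ) / n)) ^ k :=
        pow_le_pow_left₀ h1 (Real.one_sub_le_exp_neg _) _
    _ = Real.exp (-(t * (2 * k / n))) := by
        rw [← Real.exp_nat_mul]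
        congr 1
        push_cast
        ring
    _ ≤ Real.exp (-(t * 1)) :=
        Real.exp_le_exp.2 (neg_le_neg (mul_le_mul_of_nonneg_left h3 (by positivity)))
    _ = Real.exp (-1) ^ t := by
        rw [← Real.exp_nat_mul]
        congr 1
        ring
    _ ≤ _ := by
        refine pow_le_pow_left₀ (Real.exp_pos _).le ?_ _
        rw [Real.exp_neg, one_div]
        exact inv_anti₀ (by norm_num) (by have := Real.add_one_le_exp (1 : ℝ); linarith)

lemma one_add_div_pow_le {n t k : ℕ} (hn : 0 < n) (hk : k ≤ n) :
    (1 + ((2 * t : ℕ) : ℝ) / n) ^ k ≤ 8 ^ t := by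
  have hn' : (0 : ℝ) < n := by exact_mod_cast hn
  have h1 : 0 ≤ ((2 * t : ℕ) : ℝ) / n := by positivity
  calc (1 + ((2 * t : ℕ) : ℝ) / n) ^ k ≤ (1 + ((2 * t : ℕ) : ℝ) / n) ^ n :=
        pow_le_pow_right₀ (by linarith) hk
    _ ≤ Real.exp (((2 * t : ℕ) : ℝ) / n) ^ n := by
        refine pow_le_pow_left₀ (by linarith) ?_ _
        have := Real.add_one_le_exp (((2 * t : ℕ) : ℝ) / n)
        linarith
    _ = (Real.exp 1 ^ 2) ^ t := by
        rw [← pow_mul, ← Real.exp_nat_mul, ← Real.exp_nat_mul]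
        congr 1
        field_simp
    _ ≤ _ := by
        refine pow_le_pow_left₀ (by positivity) ?_ _
        calc Real.exp 1 ^ 2 ≤ 2.7182818286 ^ 2 :=
              pow_le_pow_left₀ (Real.exp_pos _).le Real.exp_one_lt_d9.le _
          _ ≤ 8 := by norm_num

/-- The coloring theorem for hypergraphs of bounded degree, with explicit size conditions. -/
theorem exists_coloring_of_degree_le {V : Type*} [Fintype V] {H : Finset (Finset V)}
    {n b r t : ℕ} (hr : 2 ≤ r) (hn2 : 2 ≤ n) (htn : Nat.clog 2 n = t)
    (ht : 20 * (b + 1) * t ≤ n)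
    (hsmall : (((8 * t + 1 : ℕ) : ℝ) * n) ^ (b + 1) * (1 / r : ℝ) ^ (n - b * (8 * t + 1)) ≤
      1 / (1152 * r))
    (hn : ∀ E ∈ H, #E = n) (hb : ∀ E ∈ H, ∀ F ∈ H, E ≠ F → #(E ∩ F) ≤ b)
    (hD : ∀ v, (#{E ∈ H | v ∈ E} : ℝ) ≤ 1 / (1152 * r ^ (b + 1)) * r ^ n) :
    ∃ f : V → Fin r, ∀ E ∈ H, ∀ i, ¬ ∀ u ∈ E, f u = i := by
  have hr' : (0 : ℝ) < r := by exact_mod_cast (by omega : 0 < r)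
  have hn' : (2 : ℝ) ≤ n := by exact_mod_cast hn2
  have : NeZero r := ⟨by omega⟩
  have : Nonempty (Fin r × Fin n) := ⟨(⟨0, by omega⟩, ⟨0, by omega⟩)⟩
  have ht0 : 0 < t := htn ▸ Nat.clog_pos (by norm_num) hn2
  have ht' : 20 * t + 20 * (b * t) ≤ n := by
    refine le_trans (le_of_eq ?_) ht; ring
  have hbn : b ≤ n := by
    have : b ≤ b * t := Nat.le_mul_of_pos_right _ ht0
    omega
  have hρ1 : (1 / r : ℝ) ≤ 1 := by
    rw [div_le_one hr']; exact_mod_cast (by omega : 1 ≤ r)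
  -- A tree has at most `8 * t` links, hence at most `8 * t + 1` edges. Half of the bound comes from
  -- the degree condition, half from `hsmall`.
  have hκ : ∀ F ⊆ H, #F ≤ 8 * t + 1 → ∀ v,
      ∑ E ∈ H with v ∈ E ∧ E ∉ F, (1 / r : ℝ) ^ #(E \ cover F) ≤ 1 / (576 * r) := by
    intro F hF hs v
    refine (sum_new_edges_le hn hb (by positivity) hρ1 hD hF hs v).trans ?_
    have h1 : 1 / (1152 * r ^ (b + 1)) * r ^ n * (1 / r : ℝ) ^ (n - b) = 1 / (1152 * r) := by
      have h2 : (r : ℝ) ^ n = r ^ (n - b) * r ^ b := by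
        rw [← pow_add, Nat.sub_add_cancel hbn]
      rw [h2, div_pow, one_pow, pow_succ]
      field_simp
    rw [h1]
    have h3 : (1 : ℝ) / (576 * r) = 1 / (1152 * r) + 1 / (1152 * r) := by
      field_simp
      norm_num
    rw [h3]
    exact add_le_add_right hsmall _
  let J : Finset (Finset V × Finset (Link V)) :=
    {T | IsLinkTree H T.1 T.2 ∧ #T.2 ≤ 2 * (4 * t)}
  -- The number of links decides which root condition applies, so each tree carries a single event.
  let G : ℕ → Fin r → Finset (Fin r × Fin n) := fun m =>
    if m < 4 * t then smallRoot (2 * t) else largeRoot (2 * t)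
  have hclog := half_pow_clog_le (n := n) (by omega)
  rw [htn] at hclog
  obtain ⟨ω, hω⟩ := local_lemma J (fun T => cover (treeEdges T.1 T.2))
    (fun T => TreeEvent (G #T.2) T.1 T.2)
    (fun T hT => (mem_filter.1 hT).2.1.determinedBy _)
    (fun T hT => by
      have h1 := (mem_filter.1 hT).2.1
      have h2 : T.1.Nonempty := by
        rw [← card_pos, hn _ h1.root_mem]; omega
      exact h2.mono fun u hu => mem_cover_of_mem_root hu)
    (1 / n) (by positivity) (by rw [div_lt_one] <;> linarith)
    (fun v => by
      rw [← sum_fiberwise_of_maps_to (t := range (2 * (4 * t) + 1)) (g := fun T => #T.2)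
        (fun T hT => mem_range.2 (Nat.lt_succ_of_le
          (mem_filter.1 (mem_filter.1 hT).1).2.2))]
      have hm : ∀ m ∈ range (2 * (4 * t) + 1),
          ∑ T ∈ J.filter (fun T => v ∈ cover (treeEdges T.1 T.2)) with #T.2 = m,
            pr (TreeEvent (G #T.2) T.1 T.2) *
              ((1 - 1 / (n : ℝ))⁻¹) ^ #(cover (treeEdges T.1 T.2)) ≤
          1 / 24 * (1 / n) * (1 / 2) ^ m := by
        intro m hm
        rw [mem_range] at hm
        have hcond : 2 * ((b + 1) * m) ≤ n := by
          have : (b + 1) * m ≤ (b + 1) * (8 * t) := Nat.mul_le_mul_left _ (by omega)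
          have : (b + 1) * (8 * t) = 8 * t + 8 * (b * t) := by ring
          omega
        have h𝒯 : ∀ T ∈ (J.filter fun T => v ∈ cover (treeEdges T.1 T.2)).filter
            (fun T => #T.2 = m),
            IsLinkTree H T.1 T.2 ∧ #T.2 = m ∧ v ∈ cover (treeEdges T.1 T.2) := by
          intro T hT
          obtain ⟨h1, h2⟩ := mem_filter.1 hT
          obtain ⟨h3, h4⟩ := mem_filter.1 h1
          exact ⟨(mem_filter.1 h3).2.1, h2, h4⟩
        have hquarter : (1 / 4 : ℝ) ^ m = (1 / 2) ^ m * (1 / 2) ^ m := by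
          rw [← mul_pow]; norm_num
        have hle1 : (1 / 2 : ℝ) ^ m ≤ 1 := pow_le_one₀ (by norm_num) (by norm_num)
        rw [sum_congr rfl fun T hT => by rw [(h𝒯 T hT).2.1]]
        by_cases hmL : m < 4 * t
        · refine (sum_pr_treeEvent_le (by omega) hn2 hn hb hκ (by omega) hcond v _ h𝒯 (G m)
            (g := 1 - ((2 * t : ℕ) : ℝ) / n) (γ := 1 / n) (fun i => ?_) (by positivity)
            (fun k hk _ => (one_sub_div_pow_le (by omega) (by omega) hk).trans hclog)).trans ?_
          · simp only [G, hmL, if_true]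
            exact card_smallRoot_le (by omega) i
          · rw [hquarter]
            refine mul_le_mul_of_nonneg_left ?_ (by positivity)
            exact mul_le_of_le_one_right (by positivity) hle1
        · refine (sum_pr_treeEvent_le (by omega) hn2 hn hb hκ (by omega) hcond v _ h𝒯 (G m)
            (g := 1 + ((2 * t : ℕ) : ℝ) / n) (γ := 8 ^ t) (fun i => ?_) (by positivity)
            (fun k _ hk => one_add_div_pow_le (by omega) hk)).trans ?_
          · simp only [G, hmL, if_false]
            exact card_largeRoot_le (by omega) i
          -- Half of the decay `4 ^ (-m)` pays for the root factor `8 ^ t` and leaves `1 / n`,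
          -- because `m ≥ 4 * t`; the other half makes the sum over `m` converge.
          · have h1 : (8 : ℝ) ^ t * (1 / 2) ^ m ≤ 1 / n := by
              calc (8 : ℝ) ^ t * (1 / 2) ^ m ≤ 8 ^ t * (1 / 2) ^ (4 * t) := by
                    refine mul_le_mul_of_nonneg_left ?_ (by positivity)
                    exact pow_le_pow_of_le_one (by norm_num) (by norm_num) (by omega)
                _ = (1 / 2) ^ t := by
                    rw [pow_mul, ← mul_pow]; norm_num
                _ ≤ _ := hclog
            rw [hquarter]
            calc _ = 1 / 24 * (8 ^ t * (1 / 2) ^ m) * (1 / 2 : ℝ) ^ m := by ring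
              _ ≤ _ := by gcongr
      refine (sum_le_sum hm).trans ?_
      rw [← mul_sum]
      have hgeom : ∑ m ∈ range (2 * (4 * t) + 1), (1 / 2 : ℝ) ^ m ≤ 2 := by
        rw [geom_sum_eq (by norm_num), div_le_iff_of_neg (by norm_num)]
        have : (0 : ℝ) < (1 / 2) ^ (2 * (4 * t) + 1) := by positivity
        linarith
      have hn0 : (0 : ℝ) < 1 / n := by positivity
      nlinarith)
  obtain ⟨R, B, τ, hR, hterm⟩ := exists_recoloring H (fun u => (ω u).1) (fun u => (ω u).2) (2 * t)
  refine ⟨recolor (fun u => (ω u).1) R, fun E hE i hmono => ?_⟩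
  obtain ⟨A, Λ, hΛ, h1 | h1⟩ := hR.exists_treeEvent hr hn (L := 4 * t) (by omega) hE hmono
    (hterm E hE i hmono)
  · refine hω (A, Λ) (mem_filter.2 ⟨mem_univ _, hΛ, by simp only; omega⟩) ?_
    simpa only [G, h1.1, if_true] using h1.2
  · refine hω (A, Λ) (mem_filter.2 ⟨mem_univ _, hΛ, h1.2.1⟩) ?_
    have : ¬ #Λ < 4 * t := by omega
    simpa only [G, this, if_false] using h1.2.2

open Filter in
/-- The size conditions hold for large `n`. -/
lemma eventually_size_conditions (b r : ℕ) (hr : 2 ≤ r) :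
    ∀ᶠ n : ℕ in atTop, 2 ≤ n ∧ 20 * (b + 1) * Nat.clog 2 n ≤ n ∧
      (((8 * Nat.clog 2 n + 1 : ℕ) : ℝ) * n) ^ (b + 1) *
        (1 / r : ℝ) ^ (n - b * (8 * Nat.clog 2 n + 1)) ≤ 1 / (1152 * r) := by
  have hr' : (2 : ℝ) ≤ r := by exact_mod_cast hr
  -- Since `b * (8 * t + 1) ≤ n / 2`, at least half of the exponent `n` survives; as `x ^ 2 = 1 /
  -- 2`, this gives the decay `x ^ n`, which beats every power of `n`.
  set x : ℝ := √(1 / 2) with hx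
  have hx0 : 0 ≤ x := Real.sqrt_nonneg _
  have hx2 : x ^ 2 = 1 / 2 := Real.sq_sqrt (by norm_num)
  have hx1 : x < 1 := by nlinarith
  have hlim := tendsto_pow_const_mul_const_pow_of_abs_lt_one (2 * (b + 1)) (r := x)
    (by rwa [abs_of_nonneg hx0])
  have hev := hlim.eventually_le_const (show (0 : ℝ) < 1 / (1152 * r) by positivity)
  -- This threshold forces `C * t ≤ (t - 1) ^ 2 ≤ 2 ^ (t - 1) < n`.
  filter_upwards [hev, eventually_gt_atTop (2 ^ (20 * (b + 1) + 3))] with n h1 h2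
  set C := 20 * (b + 1) with hC
  set t := Nat.clog 2 n with ht
  have hn2 : 2 ≤ n := by
    have : 2 ^ 1 ≤ 2 ^ (C + 3) := Nat.pow_le_pow_right (by norm_num) (by omega)
    omega
  have htC : C + 3 < t := by
    have h3 : n ≤ 2 ^ t := Nat.le_pow_clog (by norm_num) n
    exact (Nat.pow_lt_pow_iff_right (by norm_num : 1 < 2)).1 (h2.trans_le h3)
  have hCt : C * t ≤ n := by
    obtain ⟨p, hp⟩ : ∃ p, t = p + 1 := ⟨t - 1, by omega⟩
    have h3 : 2 ^ p < n := by
      have := Nat.pow_pred_clog_lt_self (b := 2) (by norm_num) (x := n) (by omega)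
      rwa [← ht, hp] at this
    have h4 : p ^ 2 ≤ 2 ^ p := by
      have : ∀ k, 4 ≤ k → k ^ 2 ≤ 2 ^ k := by
        intro k hk
        induction k, hk using Nat.le_induction with
        | base => norm_num
        | succ k hk ih =>
          rw [pow_succ 2 k]
          nlinarith
      exact this p (by omega)
    have h5 : C + 3 ≤ p := by omega
    rw [hp]
    nlinarith
  refine ⟨hn2, hCt, ?_⟩
  have hexp : C * t = 20 * t + 20 * (b * t) := by rw [hC]; ring
  have hs : 8 * t + 1 ≤ n := by omega
  have hbs : b * (8 * t + 1) ≤ 9 * (b * t) := by nlinarith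
  calc (((8 * t + 1 : ℕ) : ℝ) * n) ^ (b + 1) * (1 / r : ℝ) ^ (n - b * (8 * t + 1))
      ≤ ((n : ℝ) * n) ^ (b + 1) * (1 / 2 : ℝ) ^ (n - b * (8 * t + 1)) := by
        gcongr
    _ = (n : ℝ) ^ (2 * (b + 1)) * x ^ (2 * (n - b * (8 * t + 1))) := by
        rw [pow_mul x, hx2, pow_mul, sq]
    _ ≤ (n : ℝ) ^ (2 * (b + 1)) * x ^ n := by
        refine mul_le_mul_of_nonneg_left ?_ (by positivity)
        exact pow_le_pow_of_le_one hx0 hx1.le (by omega)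
    _ ≤ _ := h1

end CoreTheorem

/-! ### Trimming vertices of large degree -/

section Trimming

variable {V : Type*} {H : Finset (Finset V)} {n b : ℕ}

lemma exists_subset_card_eq_le (s : Finset V) (w : V → ℕ) :
    ∀ k ≤ #s, ∃ T ⊆ s, #T = k ∧ ∀ x ∈ s \ T, ∀ y ∈ T, w y ≤ w x := by
  intro k
  induction k with
  | zero => exact fun _ => ⟨∅, empty_subset _, rfl, by simp⟩
  | succ k ih =>
    intro hk
    obtain ⟨T, hT, hTk, hTw⟩ := ih (by omega)
    have hne : (s \ T).Nonempty := by
      rw [← card_pos, card_sdiff_of_subset hT]; omega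
    obtain ⟨z, hz, hmin⟩ := exists_min_image (s \ T) w hne
    obtain ⟨hzs, hzT⟩ := mem_sdiff.1 hz
    refine ⟨insert z T, insert_subset hzs hT, by rw [card_insert_of_notMem hzT, hTk], ?_⟩
    intro x hx y hy
    obtain ⟨hxs, hxT⟩ := mem_sdiff.1 hx
    have hx' : x ∈ s \ T := mem_sdiff.2 ⟨hxs, fun h => hxT (mem_insert_of_mem h)⟩
    rcases mem_insert.1 hy with rfl | hy
    · exact hmin x hx'
    · exact hTw x hx' y hy

/-- Charges the excess of `#(E ∩ Z)` over `b` to `(b + 1)`-subsets of `Z`, which distinct edges do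
not share. -/
lemma le_add_choose_succ (j b : ℕ) : j ≤ b + j.choose (b + 1) := by
  by_cases hj : j ≤ b
  · omega
  · obtain ⟨i, rfl⟩ := Nat.exists_eq_add_of_le (by omega : b + 1 ≤ j)
    clear hj
    induction i with
    | zero => simp
    | succ i ih =>
      have h1 := Nat.choose_succ_succ (b + 1 + i) b
      have h2 : 0 < (b + 1 + i).choose b := Nat.choose_pos (by omega)
      rw [show b + 1 + (i + 1) = (b + 1 + i).succ by omega, h1]
      have h3 : (b + 1 + i).choose b.succ = (b + 1 + i).choose (b + 1) := rfl
      omega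

/-- A lower bound for the number of edges from a set of vertices of large degree. -/
lemma card_mul_degree_le (hb : ∀ E ∈ H, ∀ F ∈ H, E ≠ F → #(E ∩ F) ≤ b) (Z : Finset V) {d : ℕ}
    (hd : ∀ v ∈ Z, d ≤ #{E ∈ H | v ∈ E}) : #Z * d ≤ b * #H + #Z ^ (b + 1) := by
  have hdisj : (H : Set (Finset V)).PairwiseDisjoint fun E => (E ∩ Z).powersetCard (b + 1) := by
    intro E hE F hF hne
    refine disjoint_left.2 fun T hT hT' => ?_
    obtain ⟨h1, h2⟩ := mem_powersetCard.1 hT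
    obtain ⟨h3, -⟩ := mem_powersetCard.1 hT'
    have h4 := card_le_card
      (subset_inter (h1.trans inter_subset_left) (h3.trans inter_subset_left))
    have h5 := hb E hE F hF hne
    omega
  calc #Z * d = ∑ _v ∈ Z, d := by rw [sum_const, smul_eq_mul]
    _ ≤ ∑ v ∈ Z, #{E ∈ H | v ∈ E} := sum_le_sum hd
    _ = ∑ E ∈ H, #{v ∈ Z | v ∈ E} :=
        sum_card_bipartiteAbove_eq_sum_card_bipartiteBelow fun v E => v ∈ E
    _ ≤ ∑ E ∈ H, (b + #((E ∩ Z).powersetCard (b + 1))) := by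
        refine sum_le_sum fun E _ => ?_
        have : {v ∈ Z | v ∈ E} = E ∩ Z := by ext; simp [and_comm]
        rw [this, card_powersetCard]
        exact le_add_choose_succ _ _
    _ = b * #H + #(H.biUnion fun E => (E ∩ Z).powersetCard (b + 1)) := by
        rw [sum_add_distrib, sum_const, smul_eq_mul, mul_comm, card_biUnion hdisj]
    _ ≤ b * #H + #(Z.powersetCard (b + 1)) := by
        gcongr
        exact biUnion_subset.2 fun E _ => powersetCard_mono inter_subset_right
    _ ≤ _ := by
        rw [card_powersetCard]
        gcongr
        exact Nat.choose_le_pow _ _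

/-- If `e E` is obtained from `E` by deleting `b` vertices of maximal degree and many of these
trimmed edges share a vertex, then many vertices have large degree. -/
lemma card_trimmed_le [Fintype V] (hn : ∀ E ∈ H, #E = n) (hbn : b ≤ n)
    (hb : ∀ E ∈ H, ∀ F ∈ H, E ≠ F → #(E ∩ F) ≤ b) {e : Finset V → Finset V}
    (he : ∀ E ∈ H, e E ⊆ E ∧ #(e E) = n - b ∧ ∀ x ∈ E \ e E, ∀ y ∈ e E,
      #{F ∈ H | y ∈ F} ≤ #{F ∈ H | x ∈ F}) (v : V) :
    #{E ∈ H | v ∈ e E} ≤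
      #{x : V | #{E ∈ H | v ∈ e E} ≤ #{F ∈ H | x ∈ F}} ^ b := by
  set d := #{E ∈ H | v ∈ e E} with hd
  have hdv : d ≤ #{F ∈ H | v ∈ F} := card_le_card fun E hE => by
    obtain ⟨h1, h2⟩ := mem_filter.1 hE
    exact mem_filter.2 ⟨h1, (he E h1).1 h2⟩
  calc d ≤ #(({x : V | d ≤ #{F ∈ H | x ∈ F}} : Finset V).powersetCard b) := by
        refine card_le_card_of_injOn (fun E => E \ e E) ?_ ?_
        · intro E hE
          obtain ⟨h1, h2⟩ := mem_filter.1 hE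
          obtain ⟨h3, h4, h5⟩ := he E h1
          refine mem_powersetCard.2 ⟨fun x hx => ?_, ?_⟩
          · exact mem_filter.2 ⟨mem_univ _, hdv.trans (h5 x hx v h2)⟩
          · rw [card_sdiff_of_subset h3, h4, hn E h1]; omega
        · intro E hE F hF heq
          obtain ⟨h1, h2⟩ := mem_filter.1 hE
          obtain ⟨h3, h4⟩ := mem_filter.1 hF
          simp only at heq
          by_contra hne
          -- Two edges with the same deleted `b`-set would share `v` as well, hence `b + 1`
          -- vertices.
          have h5 : insert v (E \ e E) ⊆ E ∩ F := by
            refine insert_subset (mem_inter.2 ⟨(he E h1).1 h2, (he F h3).1 h4⟩) ?_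
            refine subset_inter sdiff_subset ?_
            rw [heq]
            exact sdiff_subset
          have h6 := card_le_card h5
          rw [card_insert_of_notMem (by simp [h2]), card_sdiff_of_subset (he E h1).1,
            (he E h1).2.1, hn E h1] at h6
          have h7 := hb E h1 F h3 hne
          omega
    _ = (#{x : V | d ≤ #{F ∈ H | x ∈ F}}).choose b := card_powersetCard _ _
    _ ≤ _ := Nat.choose_le_pow _ _

lemma exists_pow_le_lt {b : ℕ} (hb : 1 ≤ b) (d : ℕ) :
    ∃ a : ℕ, 2 * a ^ b ≤ d ∧ d < 2 * (a + 1) ^ b := by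
  have hex : ∃ a : ℕ, d < 2 * (a + 1) ^ b :=
    ⟨d, by have := Nat.le_self_pow (by omega : b ≠ 0) (d + 1); omega⟩
  refine ⟨Nat.find hex, ?_, Nat.find_spec hex⟩
  rcases Nat.eq_zero_or_pos (Nat.find hex) with h0 | hpos
  · rw [h0, zero_pow (by omega)]; omega
  · have := Nat.find_min hex (m := Nat.find hex - 1) (by omega)
    rw [Nat.sub_add_cancel hpos] at this
    omega

/-- The number of edges is at least of order `d ^ (1 + 1 / b)` if `d` trimmed edges share a
vertex. -/
theorem trimmed_degree_bound [Fintype V] (hb1 : 1 ≤ b) (hn : ∀ E ∈ H, #E = n) (hbn : b ≤ n)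
    (hb : ∀ E ∈ H, ∀ F ∈ H, E ≠ F → #(E ∩ F) ≤ b) {e : Finset V → Finset V}
    (he : ∀ E ∈ H, e E ⊆ E ∧ #(e E) = n - b ∧ ∀ x ∈ E \ e E, ∀ y ∈ e E,
      #{F ∈ H | y ∈ F} ≤ #{F ∈ H | x ∈ F}) (v : V) {x : ℝ} (hx : 2 ≤ x)
    (hxd : x ≤ #{E ∈ H | v ∈ e E}) :
    1 / (4 * b) * x * (x / 2) ^ (1 / b : ℝ) ≤ #H := by
  have hcard := card_trimmed_le hn hbn hb he v
  set d := #{E ∈ H | v ∈ e E} with hd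
  set Z : Finset V := {x : V | d ≤ #{F ∈ H | x ∈ F}} with hZ
  -- The lower inequality makes the error `a ^ (b + 1)` at most half of `a * d`; the upper one gives
  -- `(d / 2) ^ (1 / b) ≤ a + 1 ≤ 2 * a`.
  obtain ⟨a, ha1, ha2⟩ := exists_pow_le_lt hb1 d
  have hb0 : b ≠ 0 := by omega
  have haZ : a ≤ #Z := (Nat.pow_le_pow_iff_left hb0).1 (by omega)
  obtain ⟨Z', hZ', hZa⟩ := exists_subset_card_eq haZ
  have h1 := card_mul_degree_le hb Z' (d := d) fun v hv => (mem_filter.1 (hZ' hv)).2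
  rw [hZa, pow_succ] at h1
  have hd2 : 2 ≤ d := by exact_mod_cast hx.trans hxd
  have ha0 : 1 ≤ a := by
    by_contra h0
    have : a = 0 := by omega
    rw [this, zero_add, one_pow] at ha2
    omega
  have hbR : (1 : ℝ) ≤ b := by exact_mod_cast hb1
  have haR : (1 : ℝ) ≤ a := by exact_mod_cast ha0
  have h1R : (a : ℝ) * d ≤ b * #H + a ^ b * a := by exact_mod_cast h1
  have ha1R : 2 * (a : ℝ) ^ b ≤ d := by exact_mod_cast ha1
  have ha2R : (d : ℝ) < 2 * (a + 1) ^ b := by exact_mod_cast ha2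
  have h2 : (a : ℝ) * d ≤ 2 * (b * #H) := by nlinarith
  have h3 : (x / 2) ^ (1 / b : ℝ) ≤ a + 1 := by
    calc (x / 2) ^ (1 / b : ℝ) ≤ (((a : ℝ) + 1) ^ b) ^ (1 / b : ℝ) := by
          refine Real.rpow_le_rpow (by linarith) (by linarith) (by positivity)
      _ = a + 1 := by
          rw [one_div]
          exact Real.pow_rpow_inv_natCast (by positivity) hb0
  calc 1 / (4 * b) * x * (x / 2) ^ (1 / b : ℝ) ≤ 1 / (4 * b) * d * (2 * a) := by
        have : (0 : ℝ) ≤ (x / 2) ^ (1 / b : ℝ) := Real.rpow_nonneg (by linarith) _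
        gcongr
        linarith
    _ = (a * d) / (2 * b) := by field_simp; norm_num
    _ ≤ #H := by
        rw [div_le_iff₀ (by linarith)]
        linarith

end Trimming

/-! ### The edge bound for large `n` and the final constant -/

open Filter in
/-- A non-colorable uniform `b`-simple family on a finite vertex set has many edges. -/
theorem card_edges_ge (b r : ℕ) (hb1 : 1 ≤ b) (hr : 2 ≤ r) :
    ∃ c : ℝ, 0 < c ∧ ∀ᶠ n : ℕ in atTop, ∀ (V : Type) [Fintype V] (H : Finset (Finset V)),
      (∀ E ∈ H, #E = n) → (∀ E ∈ H, ∀ F ∈ H, E ≠ F → #(E ∩ F) ≤ b) →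
      (¬ ∃ f : V → Fin r, ∀ E ∈ H, ∀ i, ¬ ∀ u ∈ E, f u = i) →
      c * (r : ℝ) ^ ((n : ℝ) * (1 + 1 / (b : ℝ))) ≤ #H := by
  have hr' : (2 : ℝ) ≤ r := by exact_mod_cast hr
  have hb' : (1 : ℝ) ≤ b := by exact_mod_cast hb1
  -- Trimmed edges have `n - b` vertices, so `K * r ^ n` is the degree bound of
  -- `exists_coloring_of_degree_le` at `n - b`.
  set K : ℝ := 1 / (1152 * r ^ (b + 1)) / r ^ b with hK
  have hK0 : 0 < K := by positivity
  refine ⟨1 / (4 * b) * K * (K / 2) ^ (1 / b : ℝ), by positivity, ?_⟩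
  have hbig : ∀ᶠ n : ℕ in atTop, 2 / K ≤ (r : ℝ) ^ n :=
    (tendsto_pow_atTop_atTop_of_one_lt (by linarith : (1 : ℝ) < r)).eventually_ge_atTop _
  have hsize := (tendsto_sub_atTop_nat b).eventually (eventually_size_conditions b r hr)
  filter_upwards [hbig, hsize, eventually_ge_atTop b] with n hn1 hn2 hbn V _ H hn hb hcol
  have hch : ∀ E, ∃ T, E ∈ H → T ⊆ E ∧ #T = n - b ∧ ∀ x ∈ E \ T, ∀ y ∈ T,
      #{F ∈ H | y ∈ F} ≤ #{F ∈ H | x ∈ F} := by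
    intro E
    by_cases hE : E ∈ H
    · obtain ⟨T, hT⟩ := exists_subset_card_eq_le E (fun v => #{F ∈ H | v ∈ F}) (n - b)
        (by rw [hn E hE]; omega)
      exact ⟨T, fun _ => hT⟩
    · exact ⟨∅, fun h => absurd h hE⟩
  choose e he using hch
  by_cases hdeg : ∃ v, K * r ^ n ≤ #{E ∈ H | v ∈ e E}
  · obtain ⟨v, hv⟩ := hdeg
    have h2 : 2 ≤ K * r ^ n := by
      rw [div_le_iff₀ hK0] at hn1
      linarith
    refine le_trans (le_of_eq ?_) (trimmed_degree_bound hb1 hn hbn hb he v h2 hv)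
    rw [mul_add, mul_one, Real.rpow_add (by linarith), Real.rpow_natCast, Real.rpow_mul (by linarith),
      Real.rpow_natCast, show K * (r : ℝ) ^ n / 2 = K / 2 * r ^ n by ring,
      Real.mul_rpow (by positivity) (by positivity)]
    ring
  · exfalso
    push Not at hdeg
    apply hcol
    obtain ⟨f, hf⟩ := exists_coloring_of_degree_le (H := H.image e) (n := n - b) (b := b) hr hn2.1
      rfl hn2.2.1 hn2.2.2 (by
        intro E' hE'
        obtain ⟨E, hE, rfl⟩ := mem_image.1 hE'
        exact (he E hE).2.1) (by
        intro E' hE' F' hF' hne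
        obtain ⟨E, hE, rfl⟩ := mem_image.1 hE'
        obtain ⟨F, hF, rfl⟩ := mem_image.1 hF'
        exact (card_le_card (inter_subset_inter (he E hE).1 (he F hF).1)).trans
          (hb E hE F hF fun h => hne (by rw [h]))) (by
        intro v
        have h1 : #{E ∈ H.image e | v ∈ E} ≤ #{E ∈ H | v ∈ e E} := by
          rw [filter_image]
          exact card_image_le
        have h2 : (r : ℝ) ^ n = r ^ (n - b) * r ^ b := by
          rw [← pow_add, Nat.sub_add_cancel hbn]
        have h3 := (hdeg v).le
        rw [hK, h2] at h3
        refine le_trans (by exact_mod_cast h1) (h3.trans (le_of_eq ?_))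
        field_simp)
    exact ⟨f, fun E hE i hmono => hf (e E) (mem_image_of_mem e hE) i
      fun u hu => hmono u ((he E hE).1 hu)⟩

/-- The edges of a hypergraph with finite vertex set, as finite sets of vertices. -/
theorem exists_finset_edges {α : Type} (H : Hypergraph α) [Fintype H.vertexSet] {n b r : ℕ}
    (hr : 0 < r) (hn : H.IsUniform n) (hb : H.IsSimple b) (hcol : ¬ H.IsColorable r) :
    ∃ 𝓗 : Finset (Finset H.vertexSet), (∀ E ∈ 𝓗, #E = n) ∧
      (∀ E ∈ 𝓗, ∀ F ∈ 𝓗, E ≠ F → #(E ∩ F) ≤ b) ∧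
      (¬ ∃ f : H.vertexSet → Fin r, ∀ E ∈ 𝓗, ∀ i, ¬ ∀ u ∈ E, f u = i) ∧
      #𝓗 ≤ H.edgeSet.ncard := by
  let φ : Set α → Finset H.vertexSet := fun e => univ.filter fun v => (v : α) ∈ e
  have hfin : H.edgeSet.Finite :=
    (Set.toFinite H.vertexSet).finite_subsets.subset fun e he =>
      H.subset_vertexSet_of_mem_edgeSet' he
  have hcard : ∀ s ⊆ H.vertexSet, #(φ s) = s.ncard := by
    intro s hs
    have h1 : ((↑) : H.vertexSet → α) '' (φ s : Set H.vertexSet) = s := by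
      ext x
      simp only [φ, coe_filter, mem_univ, true_and, Set.mem_image, Set.mem_ofPred_eq,
        Subtype.exists, exists_and_left, exists_prop, exists_eq_right_right]
      exact ⟨fun h => h.1, fun h => ⟨h, hs h⟩⟩
    rw [← Set.ncard_coe_finset, ← Set.ncard_image_of_injective _ Subtype.val_injective, h1]
  have hmem : ∀ E, E ∈ hfin.toFinset.image φ ↔ ∃ e ∈ H.edgeSet, φ e = E := by
    intro E; simp
  refine ⟨hfin.toFinset.image φ, ?_, ?_, ?_, ?_⟩
  · intro E hE
    obtain ⟨e, he, rfl⟩ := (hmem E).1 hE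
    rw [hcard e (H.subset_vertexSet_of_mem_edgeSet' he)]
    exact (hn e he).2
  · intro E hE F hF hne
    obtain ⟨e, he, rfl⟩ := (hmem E).1 hE
    obtain ⟨e', he', rfl⟩ := (hmem F).1 hF
    have h1 : φ e ∩ φ e' = φ (e ∩ e') := by
      ext; simp [φ]
    have h2 := hb e he e' he' fun h => hne (by rw [h])
    rw [h1, hcard _ (Set.inter_subset_left.trans (H.subset_vertexSet_of_mem_edgeSet' he))]
    have h3 : (e ∩ e').Finite := (hn e he).1.subset Set.inter_subset_left
    rw [← h3.cast_ncard_eq] at h2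
    exact_mod_cast h2
  · rintro ⟨f, hf⟩
    apply hcol
    refine ⟨f, fun e he => ?_⟩
    by_contra hcon
    push Not at hcon
    have hmono := hf (φ e) ((hmem _).2 ⟨e, he, rfl⟩)
    have hne : ¬ ∃ u, u ∈ φ e := by
      rintro ⟨u, hu⟩
      exact hmono (f u) fun w hw => hcon w u (mem_filter.1 hw).2 (mem_filter.1 hu).2
    -- An empty edge is monochromatic in every color; `hr` supplies one.
    exact hmono ⟨0, hr⟩ fun w hw => absurd ⟨w, hw⟩ hne
  · rw [Set.ncard_eq_toFinset_card _ hfin]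
    exact card_image_le

end HypergraphColoring

theorem mainTheorem3 (b : ℕ) (hb : 2 ≤ b) :
    ∃ n₀ : ℕ, ∀ r : ℕ, 2 ≤ r → ∃ c : ℝ, 0 < c ∧ ∀ n : ℕ, n₀ < n →
      c * (r : ℝ) ^ ((n : ℝ) * (1 + 1 / (b : ℝ))) ≤ (Hypergraph.minEdges n r b : ℝ) := by
  refine ⟨0, fun r hr => ?_⟩
  obtain ⟨c, hc, hev⟩ := HypergraphColoring.card_edges_ge b r (by omega) hr
  obtain ⟨N, hN⟩ := Filter.eventually_atTop.1 hev
  have hr' : (2 : ℝ) ≤ r := by exact_mod_cast hr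
  have hr1 : (1 : ℝ) ≤ r := by linarith
  have hr0 : (0 : ℝ) < r := by linarith
  have hb0 : (0 : ℝ) ≤ 1 + 1 / (b : ℝ) := by positivity
  -- For `n < N` the second term makes the left side at most 1, and a non-colorable hypergraph has
  -- an edge; hence `n₀ = 0` suffices.
  refine ⟨min c ((r : ℝ) ^ (-((N : ℝ) * (1 + 1 / (b : ℝ))))),
    lt_min hc (Real.rpow_pos_of_pos hr0 _), fun n _ => ?_⟩
  obtain ⟨α, H, hfin, hunif, hsimple, hcol, hcard⟩ :=
    Nat.sInf_mem (Hypergraph.nonColorableSizes_nonempty n r b (by omega))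
  rw [Hypergraph.minEdges, ← hcard]
  have : Fintype H.vertexSet := hfin.fintype
  obtain ⟨𝓗, h1, h2, h3, h4⟩ :=
    HypergraphColoring.exists_finset_edges H (by omega : 0 < r) hunif hsimple hcol
  have hpos : 0 < (r : ℝ) ^ ((n : ℝ) * (1 + 1 / (b : ℝ))) := Real.rpow_pos_of_pos hr0 _
  have h4' : (𝓗.card : ℝ) ≤ H.edgeSet.ncard := by exact_mod_cast h4
  refine le_trans ?_ h4'
  rcases le_or_gt N n with hn | hn
  · exact (mul_le_mul_of_nonneg_right (min_le_left _ _) hpos.le).trans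
      (hN n hn H.vertexSet 𝓗 h1 (fun E hE F hF hne => by convert h2 E hE F hF hne) h3)
  · have hne : 1 ≤ 𝓗.card := by
      rw [Nat.one_le_iff_ne_zero, Ne, Finset.card_eq_zero]
      rintro rfl
      exact h3 ⟨fun _ => ⟨0, by omega⟩, by simp⟩
    refine (mul_le_mul_of_nonneg_right (min_le_right _ _) hpos.le).trans ?_
    rw [← Real.rpow_add hr0]
    refine le_trans (Real.rpow_le_one_of_one_le_of_nonpos hr1 ?_) (by exact_mod_cast hne)
    have hnN : (n : ℝ) ≤ N := by exact_mod_cast hn.le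
    nlinarith
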